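/- Work over $\mathbb{Q}$ with graded-commutative differential graded algebras (CDGAs), graded by $\mathbb{N}$ with differential of degree $+1$. For a graded vector space $W$ let $\Lambda W$ be the free graded-commutative algebra on $W$. A minimal Sullivan algebra is a CDGA $(\Lambda W,d)$ with $W^0=W^1=0$, every $W^n$ finite-dimensional, $W=\bigcup_{j\ge 0}W(j)$ for graded subspaces $W(0)\subseteq W(1)\subseteq\cdots$ with $dW(0)=0$ and $dW(j+1)\subseteq\Lambda W(j)$, and $dW\subseteq\Lambda^{\ge 2}W$. Two morphisms $f,g\colon A\to B$ of CDGAs, with $A$ a minimal Sullivan algebra, are homotopic if there is a morphism $\Phi\colon A\to B\otimes\Lambda(t,dt)$, $|t|=0$, whose composites with the evaluations at $t=0$ and $t=1$ (and $dt=0$) are $f$ and $g$. A minimal Sullivan algebra $A=(\Lambda W,d)$ is $n$-connected if $W^i=0$ for all $i\le n$ (then also $H^0(A)=\mathbb{Q}$ and $H^i(A)=0$ for $0<i\le n$); it is homotopically rigid if every self-homotopy equivalence of $A$ is homotopic to the identity. For every even integer $k>4$ let $M_k=\big(\Lambda(x_1,x_2,y_1,y_2,y_3,z),d\big)$ with $$|x_1|=5k-2,\quad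 |x_2|=6k-2,\quad |y_1|=21k-9,\quad |y_2|=22k-9,\quad |y_3|=23k-9,\quad |z|=15k^2-11k+1,$$ $$dx_1=dx_2=0,\qquad dy_1=x_1^3x_2,\qquad dy_2=x_1^2x_2^2,\qquad dy_3=x_1x_2^3,$$ $$dz=x_1^{3k-12}\big(x_1^2y_2y_3-x_1x_2y_1y_3+x_2^2y_1y_2\big)+x_1^{\frac{6k-2}{2}}+x_2^{\frac{5k-2}{2}}.$$ **Theorem.** For every even $k>4$, $M_k$ is a $(5k-3)$-connected minimal Sullivan algebra. Homotopy is a congruence on the monoid of self-maps of $M_k$ under composition, and the quotient monoid, the monoid of homotopy classes of self-maps of $M_k$, has exactly two elements: the class of the zero map (the morphism that sends all six generators to $0$) and the class of the identity. In particular $M_k$ is homotopically rigid. Moreover, $M_k$ and $M_l$ are not homotopy equivalent for $k\ne l$; so for every $n$ infinitely many of the $M_k$, pairwise not homotopy equivalent, are $n$-connected and homotopically rigid. -/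

import Mathlib

noncomputable section

open Polynomial

/-- Graded-commutative `ℚ`-algebras, graded by the natural numbers. -/
structure CGA where
  carrier : Type
  [ring : Ring carrier]
  [algebra : Algebra ℚ carrier]
  /-- the homogeneous components -/
  deg : ℕ → Submodule ℚ carrier
  [graded : GradedAlgebra deg]
  comm : ∀ {i j : ℕ} {a b : carrier}, a ∈ deg i → b ∈ deg j →
    a * b = (-1 : ℚ) ^ (i * j) • (b * a)

attribute [instance] CGA.ring CGA.algebra CGA.graded

instance : CoeSort CGA Type := ⟨CGA.carrier⟩

/-- Degree preserving (unital) algebra homomorphisms. -/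
structure CGA.Hom (A B : CGA) extends A.carrier →ₐ[ℚ] B.carrier where
  map_deg : ∀ {n : ℕ} {a : A.carrier}, a ∈ A.deg n → toFun a ∈ B.deg n

/-- Commutative differential graded algebras over `ℚ`, with differential of degree `+1`. -/
structure CDGA extends CGA where
  d : carrier →ₗ[ℚ] carrier
  d_mem : ∀ {n : ℕ} {a : carrier}, a ∈ deg n → d a ∈ deg (n + 1)
  d_d : ∀ a : carrier, d (d a) = 0
  leibniz : ∀ {n : ℕ} {a : carrier} (b : carrier), a ∈ deg n →
    d (a * b) = d a * b + (-1 : ℚ) ^ n • (a * d b)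

instance : CoeSort CDGA Type := ⟨fun A => A.carrier⟩

/-- Morphisms of CDGAs. -/
@[ext]
structure CDGA.Hom (A B : CDGA) extends A.carrier →ₐ[ℚ] B.carrier where
  map_deg : ∀ {n : ℕ} {a : A.carrier}, a ∈ A.deg n → toFun a ∈ B.deg n
  map_d : ∀ a : A.carrier, toFun (A.d a) = B.d (toFun a)

namespace CDGA

instance (A B : CDGA) : CoeFun (Hom A B) (fun _ => A.carrier → B.carrier) :=
  ⟨fun f => f.toAlgHom⟩

/-- The identity morphism. -/
def Hom.id (A : CDGA) : Hom A A where
  toAlgHom := AlgHom.id ℚ A.carrier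
  map_deg := fun h => h
  map_d := fun _ => rfl

/-- Composition of morphisms. -/
def Hom.comp {A B C : CDGA} (g : Hom B C) (f : Hom A B) : Hom A C where
  toAlgHom := g.toAlgHom.comp f.toAlgHom
  map_deg := fun h => g.map_deg (f.map_deg h)
  map_d := fun a => (congrArg g.toFun (f.map_d a)).trans (g.map_d _)

/-- The monoid of self-maps of a CDGA under composition. -/
instance (A : CDGA) : Monoid (Hom A A) where
  one := Hom.id A
  mul g f := g.comp f
  mul_assoc _ _ _ := rfl
  one_mul _ := rfl
  mul_one _ := rfl

end CDGA

/-! ### Gradings from projections -/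

/-- A family of submodules that spans and admits projections is a direct sum decomposition. -/
theorem isInternal_of_proj {V : Type} [AddCommGroup V] [Module ℚ V] (S : ℕ → Submodule ℚ V)
    (P : ℕ → V →ₗ[ℚ] V) (h1 : ∀ n, ∀ a ∈ S n, P n a = a)
    (h2 : ∀ n m, n ≠ m → ∀ a ∈ S m, P n a = 0) (h3 : ⨆ n, S n = ⊤) :
    DirectSum.IsInternal S := by
  rw [DirectSum.isInternal_submodule_iff_iSupIndep_and_iSup_eq_top]
  refine ⟨?_, h3⟩
  rw [iSupIndep_def]
  intro n
  rw [Submodule.disjoint_def]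
  intro x hx hx'
  have : (⨆ j, ⨆ (_ : j ≠ n), S j) ≤ LinearMap.ker (P n) :=
    iSup_le fun j => iSup_le fun hj => fun a ha => h2 n j (Ne.symm hj) a ha
  rw [← h1 n x hx]
  exact this hx'

/-! ### The free graded-commutative algebra on a graded set of generators -/

section Free

variable {ι : Type} (w : ι → ℕ)

/-- The relations `e_i e_j = (-1)^{|e_i||e_j|} e_j e_i`. -/
inductive FreeCGA.Rel : FreeAlgebra ℚ ι → FreeAlgebra ℚ ι → Prop
  | swap (i j : ι) : FreeCGA.Rel (FreeAlgebra.ι ℚ i * FreeAlgebra.ι ℚ j)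
      ((-1 : ℚ) ^ (w i * w j) • (FreeAlgebra.ι ℚ j * FreeAlgebra.ι ℚ i))

/-- The free graded-commutative algebra `Λ(e_i)` on generators `e_i` of degree `w i`. (As `2` is
invertible the relations give `e_i ^ 2 = 0` for `w i` odd.) -/
def FreeCGA : Type := RingQuot (FreeCGA.Rel w)

instance : Ring (FreeCGA w) := inferInstanceAs (Ring (RingQuot (FreeCGA.Rel w)))
instance : Algebra ℚ (FreeCGA w) := inferInstanceAs (Algebra ℚ (RingQuot (FreeCGA.Rel w)))

namespace FreeCGA

/-- The quotient map from the free associative algebra. -/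
def mk : FreeAlgebra ℚ ι →ₐ[ℚ] FreeCGA w := RingQuot.mkAlgHom ℚ (Rel w)

/-- The generators. -/
def gen (i : ι) : FreeCGA w := mk w (FreeAlgebra.ι ℚ i)

/-- The algebra homomorphism with prescribed values on the generators. -/
def lift {B : Type} [Ring B] [Algebra ℚ B] (f : ι → B)
    (hf : ∀ i j, f i * f j = (-1 : ℚ) ^ (w i * w j) • (f j * f i)) : FreeCGA w →ₐ[ℚ] B :=
  RingQuot.liftAlgHom ℚ ⟨FreeAlgebra.lift ℚ f, by
    rintro _ _ ⟨i, j⟩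
    simp [hf i j]⟩

theorem lift_gen {B : Type} [Ring B] [Algebra ℚ B] (f : ι → B)
    (hf : ∀ i j, f i * f j = (-1 : ℚ) ^ (w i * w j) • (f j * f i)) (i : ι) :
    lift w f hf (gen w i) = f i := by
  unfold lift gen mk FreeCGA
  exact (RingQuot.liftAlgHom_mkAlgHom_apply ..).trans (FreeAlgebra.lift_ι_apply ..)

theorem gen_mul_gen (i j : ι) :
    gen w i * gen w j = (-1 : ℚ) ^ (w i * w j) • (gen w j * gen w i) := by
  have h : mk w (FreeAlgebra.ι ℚ i * FreeAlgebra.ι ℚ j) =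
      mk w ((-1 : ℚ) ^ (w i * w j) • (FreeAlgebra.ι ℚ j * FreeAlgebra.ι ℚ i)) :=
    RingQuot.mkAlgHom_rel ℚ (Rel.swap (w := w) i j)
  rwa [map_smul, map_mul, map_mul] at h

/-- Products of generators. -/
def word (l : List ι) : FreeCGA w := (l.map (gen w)).prod

/-- The degree of a product of generators. -/
def wt (l : List ι) : ℕ := (l.map w).sum

/-- The component of degree `n`: the span of the products of generators of total degree `n`. -/
def deg (n : ℕ) : Submodule ℚ (FreeCGA w) := Submodule.span ℚ {a | ∃ l, wt w l = n ∧ word w l = a}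

@[simp] theorem word_nil : word w [] = 1 := rfl
@[simp] theorem word_cons (i : ι) (l : List ι) : word w (i :: l) = gen w i * word w l := by
  simp [word]
@[simp] theorem wt_nil : wt w [] = 0 := rfl
@[simp] theorem wt_cons (i : ι) (l : List ι) : wt w (i :: l) = w i + wt w l := by
  simp [wt]
theorem word_append (l l' : List ι) : word w (l ++ l') = word w l * word w l' := by
  simp [word]
theorem wt_append (l l' : List ι) : wt w (l ++ l') = wt w l + wt w l' := by
  simp [wt]

theorem word_mem (l : List ι) : word w l ∈ deg w (wt w l) := Submodule.subset_span ⟨l, rfl, rfl⟩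

theorem gen_mem (i : ι) : gen w i ∈ deg w (w i) := by simpa using word_mem w [i]

theorem one_mem : (1 : FreeCGA w) ∈ deg w 0 := word_mem w []

theorem mul_mem {m n : ℕ} {a b : FreeCGA w} (ha : a ∈ deg w m) (hb : b ∈ deg w n) :
    a * b ∈ deg w (m + n) := by
  have h : deg w m * deg w n ≤ deg w (m + n) := by
    rw [deg, deg, Submodule.span_mul_span, Submodule.span_le]
    rintro _ ⟨_, ⟨l, rfl, rfl⟩, _, ⟨l', rfl, rfl⟩, rfl⟩
    simp only [← word_append, ← wt_append]
    exact word_mem w _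
  exact h (Submodule.mul_mem_mul ha hb)

theorem span_word : Submodule.span ℚ (Set.range (word w)) = ⊤ := by
  set S := Submodule.span ℚ (Set.range (word w)) with hS
  have h1 : (1 : FreeCGA w) ∈ S := Submodule.subset_span ⟨[], rfl⟩
  have hmul : ∀ {a b}, a ∈ S → b ∈ S → a * b ∈ S := by
    intro a b ha hb
    have h : S * S ≤ S := by
      rw [hS, Submodule.span_mul_span, Submodule.span_le]
      rintro _ ⟨_, ⟨l, rfl⟩, _, ⟨l', rfl⟩, rfl⟩
      exact Submodule.subset_span ⟨l ++ l', word_append w l l'⟩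
    exact h (Submodule.mul_mem_mul ha hb)
  rw [eq_top_iff]
  rintro x -
  obtain ⟨y, rfl⟩ : ∃ y, mk w y = x := RingQuot.mkAlgHom_surjective ℚ (Rel w) x
  induction y using FreeAlgebra.induction with
  | grade0 r =>
    rw [AlgHom.commutes, Algebra.algebraMap_eq_smul_one]
    exact S.smul_mem _ h1
  | grade1 i => exact Submodule.subset_span ⟨[i], by simp [gen]⟩
  | mul a b ha hb => rw [map_mul]; exact hmul ha hb
  | add a b ha hb => rw [map_add]; exact S.add_mem ha hb

theorem iSup_deg : ⨆ n, deg w n = ⊤ := by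
  rw [eq_top_iff, ← span_word, Submodule.span_le]
  rintro _ ⟨l, rfl⟩
  exact Submodule.mem_iSup_of_mem _ (word_mem w l)

/-- Linear maps that agree on the products of generators are equal. -/
theorem linear_ext {V : Type} [AddCommGroup V] [Module ℚ V] {f g : FreeCGA w →ₗ[ℚ] V}
    (h : ∀ l, f (word w l) = g (word w l)) : f = g :=
  LinearMap.ext_on_range (span_word w) h

/-- The algebra homomorphism `a ↦ a T^n` for `a` of degree `n`. -/
def weight : FreeCGA w →ₐ[ℚ] (FreeCGA w)[X] :=
  lift w (fun i => monomial (w i) (gen w i)) (fun i j => by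
    rw [monomial_mul_monomial, monomial_mul_monomial, gen_mul_gen, smul_monomial, add_comm])

theorem weight_word (l : List ι) : weight w (word w l) = monomial (wt w l) (word w l) := by
  induction l with
  | nil => simp
  | cons i l ih =>
    rw [word_cons, map_mul, ih, weight, lift_gen, monomial_mul_monomial, wt_cons]

theorem weight_deg {n : ℕ} {a : FreeCGA w} (ha : a ∈ deg w n) : weight w a = monomial n a := by
  induction ha using Submodule.span_induction with
  | mem x hx => obtain ⟨l, rfl, rfl⟩ := hx; exact weight_word w l
  | zero => simp
  | add x y _ _ hx hy => rw [map_add, hx, hy, map_add]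
  | smul c x _ hx => rw [map_smul, hx, smul_monomial]

theorem isInternal : DirectSum.IsInternal (deg w) := by
  refine isInternal_of_proj (deg w)
    (fun n => ((lcoeff (FreeCGA w) n).restrictScalars ℚ) ∘ₗ (weight w).toLinearMap) ?_ ?_
    (iSup_deg w)
  · intro n a ha
    simp [weight_deg w ha]
  · intro n m hnm a ha
    simp [weight_deg w ha, coeff_monomial, Ne.symm hnm]

instance : SetLike.GradedMonoid (deg w) where
  one_mem := one_mem w
  mul_mem _ _ _ _ ha hb := mul_mem w ha hb

instance : GradedAlgebra (deg w) where
  toDecomposition := (isInternal w).chooseDecomposition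

theorem gen_mul_word (i : ι) (l : List ι) :
    gen w i * word w l = (-1 : ℚ) ^ (w i * wt w l) • (word w l * gen w i) := by
  induction l with
  | nil => simp
  | cons j l ih =>
    rw [word_cons, ← mul_assoc, gen_mul_gen, smul_mul_assoc, mul_assoc, ih, mul_smul_comm,
      smul_smul, wt_cons, ← pow_add, mul_add, ← mul_assoc]

theorem word_mul_word (l l' : List ι) :
    word w l * word w l' = (-1 : ℚ) ^ (wt w l * wt w l') • (word w l' * word w l) := by
  induction l with
  | nil => simp
  | cons j l ih =>
    rw [word_cons, mul_assoc, ih, mul_smul_comm, ← mul_assoc, gen_mul_word, smul_mul_assoc,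
      smul_smul, wt_cons, ← pow_add, add_mul, mul_assoc, add_comm]

theorem mul_comm_deg {i j : ℕ} {a b : FreeCGA w} (ha : a ∈ deg w i) (hb : b ∈ deg w j) :
    a * b = (-1 : ℚ) ^ (i * j) • (b * a) := by
  induction ha using Submodule.span_induction with
  | mem x hx =>
    obtain ⟨l, rfl, rfl⟩ := hx
    induction hb using Submodule.span_induction with
    | mem y hy => obtain ⟨l', rfl, rfl⟩ := hy; exact word_mul_word w l l'
    | zero => simp
    | add x y _ _ hx hy => rw [mul_add, hx, hy, add_mul, smul_add]
    | smul c x _ hx => rw [mul_smul_comm, hx, smul_mul_assoc, smul_comm]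
  | zero => simp
  | add x y _ _ hx hy => rw [mul_add, add_mul, hx, hy, smul_add]
  | smul c x _ hx => rw [mul_smul_comm, smul_mul_assoc, hx, smul_comm]

/-- `Λ(e_i)` as a graded-commutative algebra. -/
def toCGA : CGA where
  carrier := FreeCGA w
  deg := deg w
  comm := mul_comm_deg w

/-! #### Derivations with prescribed values on the generators -/

variable {w} (v : ι → FreeCGA w) (hv : ∀ i, v i ∈ deg w (w i + 1))

/-- The homomorphism `a ↦ [[(-1)^|a| a, d a], [0, a]]`, where `d e_i = v_i`. -/
def derivMatrix : FreeCGA w →ₐ[ℚ] Matrix (Fin 2) (Fin 2) (FreeCGA w) :=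
  lift w (fun i => !![(-1 : ℚ) ^ w i • gen w i, v i; 0, gen w i]) (fun i j => by
    have h1 : v i * gen w j = (-1 : ℚ) ^ ((w i + 1) * w j) • (gen w j * v i) :=
      mul_comm_deg w (hv i) (gen_mem w j)
    have h2 : gen w i * v j = (-1 : ℚ) ^ (w i * (w j + 1)) • (v j * gen w i) :=
      mul_comm_deg w (gen_mem w i) (hv j)
    have e1 : ∀ n : ℕ, (-1 : ℚ) ^ n * (-1) ^ n = 1 := fun n => by
      rw [← mul_pow]; simp
    ext a b
    fin_cases a <;> fin_cases b
    · simp only [Matrix.mul_apply, Fin.sum_univ_two, Matrix.smul_apply]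
      simp [gen_mul_gen w i j, smul_smul, mul_comm, mul_left_comm]
      ring_nf
    · simp only [Matrix.mul_apply, Fin.sum_univ_two, Matrix.smul_apply]
      simp only [Matrix.of_apply, Matrix.cons_val', Matrix.cons_val_zero, Matrix.cons_val_one,
        Fin.zero_eta, Fin.mk_one, Matrix.cons_val_fin_one, smul_mul_assoc, h1, h2, smul_add,
        smul_smul]
      rw [add_comm]
      congr 2
      · ring
      · rw [mul_add, mul_one, pow_add, mul_left_comm, e1, mul_one]
    · simp [Matrix.mul_apply, Fin.sum_univ_two]
    · simp only [Matrix.mul_apply, Fin.sum_univ_two, Matrix.smul_apply]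
      simp [gen_mul_gen w i j])

/-- The derivation of degree `+1` with `d e_i = v_i`. -/
def deriv : FreeCGA w →ₗ[ℚ] FreeCGA w where
  toFun a := derivMatrix v hv a 0 1
  map_add' a b := by simp
  map_smul' c a := by simp

theorem deriv_gen (i : ι) : deriv v hv (gen w i) = v i := by
  change derivMatrix v hv (gen w i) 0 1 = v i
  rw [derivMatrix, lift_gen]
  simp

theorem deriv_one : deriv v hv 1 = 0 := by
  change derivMatrix v hv 1 0 1 = 0
  rw [map_one]; simp

theorem derivMatrix_lower (a : FreeCGA w) :
    derivMatrix v hv a 1 0 = 0 ∧ derivMatrix v hv a 1 1 = a := by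
  have : a ∈ Submodule.span ℚ (Set.range (word w)) := by rw [span_word]; trivial
  induction this using Submodule.span_induction with
  | mem x hx =>
    obtain ⟨l, rfl⟩ := hx
    induction l with
    | nil => simp
    | cons i l ih =>
      rw [word_cons, map_mul, Matrix.mul_apply, Matrix.mul_apply, Fin.sum_univ_two,
        Fin.sum_univ_two, ih.1, ih.2, derivMatrix, lift_gen]
      simp
  | zero => simp
  | add x y _ _ hx hy => simp [hx, hy]
  | smul c x _ hx => simp [hx]

theorem derivMatrix_deg {n : ℕ} {a : FreeCGA w} (ha : a ∈ deg w n) :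
    derivMatrix v hv a 0 0 = (-1 : ℚ) ^ n • a := by
  induction ha using Submodule.span_induction with
  | mem x hx =>
    obtain ⟨l, rfl, rfl⟩ := hx
    induction l with
    | nil => simp
    | cons i l ih =>
      rw [word_cons, map_mul, Matrix.mul_apply, Fin.sum_univ_two, ih, (derivMatrix_lower v hv _).1,
        derivMatrix, lift_gen, wt_cons]
      simp [smul_smul, pow_add, mul_comm]
  | zero => simp
  | add x y _ _ hx hy => simp [hx, hy]
  | smul c x _ hx => rw [map_smul, Matrix.smul_apply, hx, smul_comm]

theorem deriv_mul {n : ℕ} {a : FreeCGA w} (b : FreeCGA w) (ha : a ∈ deg w n) :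
    deriv v hv (a * b) = deriv v hv a * b + (-1 : ℚ) ^ n • (a * deriv v hv b) := by
  change derivMatrix v hv (a * b) 0 1 = derivMatrix v hv a 0 1 * b + _ • (a * derivMatrix v hv b 0 1)
  rw [map_mul, Matrix.mul_apply, Fin.sum_univ_two, derivMatrix_deg v hv ha,
    (derivMatrix_lower v hv b).2, smul_mul_assoc, add_comm]

theorem deriv_mem {n : ℕ} {a : FreeCGA w} (ha : a ∈ deg w n) :
    deriv v hv a ∈ deg w (n + 1) := by
  induction ha using Submodule.span_induction with
  | mem x hx =>
    obtain ⟨l, rfl, rfl⟩ := hx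
    induction l with
    | nil => simp [deriv_one]
    | cons i l ih =>
      rw [word_cons, deriv_mul v hv _ (gen_mem w i), deriv_gen, wt_cons]
      refine Submodule.add_mem _ ?_ (Submodule.smul_mem _ _ ?_)
      · have := mul_mem w (hv i) (word_mem w l)
        rwa [add_right_comm] at this
      · rw [add_assoc]
        exact mul_mem w (gen_mem w i) ih
  | zero => simp
  | add x y _ _ hx hy => rw [map_add]; exact Submodule.add_mem _ hx hy
  | smul c x _ hx => rw [map_smul]; exact Submodule.smul_mem _ _ hx

theorem deriv_deriv (h0 : ∀ i, deriv v hv (v i) = 0) (a : FreeCGA w) :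
    deriv v hv (deriv v hv a) = 0 := by
  have : deriv v hv ∘ₗ deriv v hv = 0 := by
    refine linear_ext w fun l => ?_
    simp only [LinearMap.comp_apply, LinearMap.zero_apply]
    induction l with
    | nil => simp [deriv_one]
    | cons i l ih =>
      rw [word_cons, deriv_mul v hv _ (gen_mem w i), deriv_gen, map_add, map_smul,
        deriv_mul v hv _ (hv i), deriv_mul v hv _ (gen_mem w i), ih, h0, deriv_gen, pow_succ]
      simp
  exact LinearMap.congr_fun this a

/-- The CDGA `(Λ(e_i), d)` with `|e_i| = w i` and `d e_i = v_i`. -/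
def toCDGA (h0 : ∀ i, deriv v hv (v i) = 0) : CDGA where
  toCGA := toCGA w
  d := deriv v hv
  d_mem := deriv_mem v hv
  d_d := deriv_deriv v hv h0
  leibniz := deriv_mul v hv

/-- The augmentation `e_i ↦ 0`. -/
def aug (w : ι → ℕ) : FreeCGA w →ₐ[ℚ] ℚ := lift w (fun _ => 0) (by simp)

theorem aug_deg {n : ℕ} {a : FreeCGA w} (ha : a ∈ deg w n) (hn : n ≠ 0) : aug w a = 0 := by
  induction ha using Submodule.span_induction with
  | mem x hx =>
    obtain ⟨l, rfl, rfl⟩ := hx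
    cases l with
    | nil => simp at hn
    | cons i l => rw [word_cons, map_mul, aug, lift_gen, zero_mul]
  | zero => simp
  | add x y _ _ hx hy => rw [map_add, hx, hy, add_zero]
  | smul c x _ hx => rw [map_smul, hx, smul_zero]

theorem aug_deriv (a : FreeCGA w) : aug w (deriv v hv a) = 0 := by
  have : (aug w).toLinearMap ∘ₗ deriv v hv = 0 := by
    refine linear_ext w fun l => ?_
    exact aug_deg (deriv_mem v hv (word_mem w l)) (Nat.succ_ne_zero _)
  exact LinearMap.congr_fun this a

/-- The zero map of `(Λ(e_i), d)`: the (unital) morphism with `e_i ↦ 0` for all `i`. -/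
def zeroMap (h0 : ∀ i, deriv v hv (v i) = 0) :
    CDGA.Hom (toCDGA v hv h0) (toCDGA v hv h0) where
  toAlgHom := (Algebra.ofId ℚ (FreeCGA w)).comp (aug w)
  map_deg := by
    intro n a ha
    change algebraMap ℚ (FreeCGA w) (aug w a) ∈ deg w n
    rcases eq_or_ne n 0 with rfl | hn
    · rw [Algebra.algebraMap_eq_smul_one]
      exact Submodule.smul_mem _ _ (one_mem w)
    · rw [aug_deg (w := w) ha hn, map_zero]
      exact Submodule.zero_mem _
  map_d := by
    intro (a : FreeCGA w)
    change algebraMap ℚ (FreeCGA w) (aug w (deriv v hv a))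
      = deriv v hv (algebraMap ℚ (FreeCGA w) (aug w a))
    rw [aug_deriv, map_zero, Algebra.algebraMap_eq_smul_one, map_smul, deriv_one, smul_zero]

end FreeCGA

end Free

/-! ### The path object `A ⊗ Λ(t, dt)` -/

/-- The sign involution `a ↦ (-1)^|a| a`. -/
def CGA.sign (A : CGA) : A.carrier →ₗ[ℚ] A.carrier :=
  (DirectSum.toModule ℚ ℕ A.carrier (fun i => (-1 : ℚ) ^ i • (A.deg i).subtype)) ∘ₗ
    (DirectSum.decomposeLinearEquiv A.deg).toLinearMap

theorem CGA.sign_deg (A : CGA) {n : ℕ} {a : A.carrier} (ha : a ∈ A.deg n) :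
    A.sign a = (-1 : ℚ) ^ n • a := by
  lift a to A.deg n using ha
  simp [CGA.sign, DirectSum.toModule_lof]

theorem CGA.sign_mul (A : CGA) (a b : A.carrier) : A.sign (a * b) = A.sign a * A.sign b := by
  induction a using DirectSum.Decomposition.inductionOn A.deg with
  | zero => simp
  | add x y hx hy => rw [add_mul, map_add, map_add, hx, hy, add_mul]
  | homogeneous x =>
    induction b using DirectSum.Decomposition.inductionOn A.deg with
    | zero => simp
    | add x y hx hy => rw [mul_add, map_add, map_add, hx, hy, mul_add]
    | homogeneous y =>
      rw [A.sign_deg x.2, A.sign_deg y.2, A.sign_deg (SetLike.mul_mem_graded x.2 y.2)]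
      simp [smul_smul, pow_add, mul_comm]

theorem CGA.sign_one (A : CGA) : A.sign 1 = 1 := by
  simpa using A.sign_deg (SetLike.one_mem_graded A.deg)

theorem CDGA.sign_d (A : CDGA) (a : A.carrier) : A.sign (A.d a) = - A.d (A.sign a) := by
  induction a using DirectSum.Decomposition.inductionOn A.deg with
  | zero => simp
  | add x y hx hy => simp only [map_add, hx, hy, neg_add]
  | homogeneous x => rw [A.sign_deg x.2, A.sign_deg (A.d_mem x.2), map_smul, pow_succ]; simp

theorem CDGA.d_mul (A : CDGA) (a b : A.carrier) :
    A.d (a * b) = A.d a * b + A.sign a * A.d b := by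
  induction a using DirectSum.Decomposition.inductionOn A.deg with
  | zero => simp
  | add x y hx hy =>
    simp only [map_add, hx, hy, add_mul]; abel
  | homogeneous x => rw [A.sign_deg x.2, A.leibniz b x.2, smul_mul_assoc]

/-- A linear map applied to the coefficients of a polynomial. -/
def coeffMap {A : Type} [Ring A] [Algebra ℚ A] (f : A →ₗ[ℚ] A) : A[X] →ₗ[ℚ] A[X] :=
  Polynomial.lsum fun n => ((monomial n : A →ₗ[A] A[X]).restrictScalars ℚ) ∘ₗ f

section coeffMap

variable {A : Type} [Ring A] [Algebra ℚ A]

theorem coeffMap_monomial (f : A →ₗ[ℚ] A) (n : ℕ) (a : A) :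
    coeffMap f (monomial n a) = monomial n (f a) := by
  simp [coeffMap, Polynomial.lsum, sum_monomial_index]

theorem coeff_coeffMap (f : A →ₗ[ℚ] A) (p : A[X]) (n : ℕ) :
    (coeffMap f p).coeff n = f (p.coeff n) := by
  induction p using Polynomial.induction_on' with
  | add p q hp hq => simp [hp, hq]
  | monomial m a =>
    rw [coeffMap_monomial, coeff_monomial, coeff_monomial]
    split_ifs <;> simp

theorem derivative_coeffMap (f : A →ₗ[ℚ] A) (p : A[X]) :
    derivative (coeffMap f p) = coeffMap f (derivative p) := by
  ext n
  rw [coeff_coeffMap, coeff_derivative, coeff_derivative, coeff_coeffMap]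
  have h : ∀ a : A, a * ((n : A) + 1) = (n + 1) • a := fun a => by
    rw [nsmul_eq_mul, Nat.cast_add, Nat.cast_one, ((Nat.cast_commute n a).add_left
      (Commute.one_left a)).eq]
  rw [h, h, map_nsmul]

end coeffMap

/-- The underlying space of `A ⊗ Λ(t, dt)`, where `|t| = 0`, `|dt| = 1`: the pair `(p, q)` of
polynomials in `t` with coefficients in `A` stands for `p(t) + q(t) dt`. -/
def PathAlg (A : CGA) : Type := A.carrier[X] × A.carrier[X]

namespace PathAlg

variable {A : CGA}

instance : AddCommGroup (PathAlg A) := inferInstanceAs (AddCommGroup (A.carrier[X] × A.carrier[X]))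
instance : Module ℚ (PathAlg A) := inferInstanceAs (Module ℚ (A.carrier[X] × A.carrier[X]))

/-- The element `p + q dt`. -/
def mk (p q : A.carrier[X]) : PathAlg A := (p, q)

@[simp] theorem mk_fst (p q : A.carrier[X]) : (mk p q : PathAlg A).1 = p := rfl
@[simp] theorem mk_snd (p q : A.carrier[X]) : (mk p q : PathAlg A).2 = q := rfl

@[ext] theorem ext {x y : PathAlg A} (h1 : x.1 = y.1) (h2 : x.2 = y.2) : x = y := Prod.ext h1 h2

/-- The sign involution on the coefficients. -/
def tau : A.carrier[X] →ₗ[ℚ] A.carrier[X] := coeffMap A.sign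

theorem tau_mul (p q : A.carrier[X]) : tau (p * q) = tau p * tau q := by
  ext n
  simp [tau, coeff_coeffMap, coeff_mul, A.sign_mul]

theorem tau_one : tau (1 : A.carrier[X]) = 1 := by
  rw [← monomial_zero_one, tau, coeffMap_monomial, A.sign_one]

instance : One (PathAlg A) := ⟨mk 1 0⟩

/-- `(p + q dt) (p' + q' dt) = p p' + (p q' + q τ(p')) dt`, by the Koszul sign rule. -/
instance : Mul (PathAlg A) :=
  ⟨fun x y => mk (x.1 * y.1) (x.1 * y.2 + x.2 * tau y.1)⟩

@[simp] theorem one_fst : (1 : PathAlg A).1 = 1 := rfl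
@[simp] theorem one_snd : (1 : PathAlg A).2 = 0 := rfl
@[simp] theorem zero_fst : (0 : PathAlg A).1 = 0 := rfl
@[simp] theorem zero_snd : (0 : PathAlg A).2 = 0 := rfl
@[simp] theorem add_fst (x y : PathAlg A) : (x + y).1 = x.1 + y.1 := rfl
@[simp] theorem add_snd (x y : PathAlg A) : (x + y).2 = x.2 + y.2 := rfl
@[simp] theorem smul_fst (c : ℚ) (x : PathAlg A) : (c • x).1 = c • x.1 := rfl
@[simp] theorem smul_snd (c : ℚ) (x : PathAlg A) : (c • x).2 = c • x.2 := rfl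
@[simp] theorem mul_fst (x y : PathAlg A) : (x * y).1 = x.1 * y.1 := rfl
@[simp] theorem mul_snd (x y : PathAlg A) : (x * y).2 = x.1 * y.2 + x.2 * tau y.1 := rfl

instance : Ring (PathAlg A) :=
  { (inferInstance : AddCommGroup (PathAlg A)), (inferInstance : One (PathAlg A)),
    (inferInstance : Mul (PathAlg A)) with
    zero_mul := fun a => by ext1 <;> simp
    mul_zero := fun a => by ext1 <;> simp
    one_mul := fun a => by ext1 <;> simp
    mul_one := fun a => by ext1 <;> simp [tau_one]
    left_distrib := fun a b c => by ext1 <;> simp [mul_add]; abel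
    right_distrib := fun a b c => by ext1 <;> simp [add_mul]; abel
    mul_assoc := fun a b c => by ext1 <;> simp [mul_add, add_mul, tau_mul, mul_assoc, add_assoc] }

instance : Algebra ℚ (PathAlg A) :=
  Algebra.ofModule (fun c x y => by ext1 <;> simp) (fun c x y => by ext1 <;> simp)

/-- Polynomials in `t` with coefficients in `A^n`. -/
def polyDeg (A : CGA) (n : ℕ) : Submodule ℚ A.carrier[X] where
  carrier := {p | ∀ m, p.coeff m ∈ A.deg n}
  add_mem' hp hq m := by rw [coeff_add]; exact Submodule.add_mem _ (hp m) (hq m)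
  zero_mem' m := by simp
  smul_mem' c p hp m := by rw [coeff_smul]; exact Submodule.smul_mem _ _ (hp m)

/-- Polynomials in `t` with coefficients in `A^(n-1)`, where `A^(-1) = 0`. -/
def polyDegPred (A : CGA) : ℕ → Submodule ℚ A.carrier[X]
  | 0 => ⊥
  | n + 1 => polyDeg A n

/-- The elements `p + q dt` of degree `n`: `p` has coefficients in `A^n`, `q` in `A^(n-1)`. -/
def deg (A : CGA) (n : ℕ) : Submodule ℚ (PathAlg A) :=
  Submodule.prod (polyDeg A n) (polyDegPred A n)

theorem mem_deg {n : ℕ} {x : PathAlg A} :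
    x ∈ deg A n ↔ x.1 ∈ polyDeg A n ∧ x.2 ∈ polyDegPred A n := Iff.rfl

theorem tau_polyDeg {n : ℕ} {p : A.carrier[X]} (hp : p ∈ polyDeg A n) :
    tau p = (-1 : ℚ) ^ n • p := by
  ext m
  rw [tau, coeff_coeffMap, A.sign_deg (hp m), coeff_smul]

theorem tau_polyDegPred {n : ℕ} {p : A.carrier[X]} (hp : p ∈ polyDegPred A n) :
    tau p = -((-1 : ℚ) ^ n • p) := by
  cases n with
  | zero => rw [show p = 0 from hp]; simp
  | succ n => rw [tau_polyDeg (n := n) hp, pow_succ]; simp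

theorem mul_polyDeg {i j : ℕ} {p q : A.carrier[X]} (hp : p ∈ polyDeg A i) (hq : q ∈ polyDeg A j) :
    p * q ∈ polyDeg A (i + j) := by
  intro m
  rw [coeff_mul]
  exact Submodule.sum_mem _ fun x _ => SetLike.mul_mem_graded (hp x.1) (hq x.2)

theorem comm_polyDeg {i j : ℕ} {p q : A.carrier[X]} (hp : p ∈ polyDeg A i)
    (hq : q ∈ polyDeg A j) : p * q = (-1 : ℚ) ^ (i * j) • (q * p) := by
  ext m
  rw [coeff_smul, coeff_mul, coeff_mul, Finset.smul_sum,
    ← Finset.Nat.sum_antidiagonal_swap]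
  exact Finset.sum_congr rfl fun x _ => A.comm (hp _) (hq _)

theorem mul_polyDegPred {i j : ℕ} {p q : A.carrier[X]} (hp : p ∈ polyDeg A i)
    (hq : q ∈ polyDegPred A j) : p * q ∈ polyDegPred A (i + j) := by
  cases j with
  | zero => rw [show q = 0 from hq, mul_zero]; exact Submodule.zero_mem _
  | succ j => exact mul_polyDeg hp hq

theorem comm_polyDegPred {i j : ℕ} {p q : A.carrier[X]} (hp : p ∈ polyDeg A i)
    (hq : q ∈ polyDegPred A j) : p * q = (-1 : ℚ) ^ (i * j + i) • (q * p) := by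
  cases j with
  | zero => rw [show q = 0 from hq]; simp
  | succ j =>
    rw [comm_polyDeg (j := j) hp hq]
    congr 1
    rw [mul_add, mul_one, add_assoc, pow_add _ (i * j) (i + i), ← two_mul, pow_mul]
    simp

theorem one_mem : (1 : PathAlg A) ∈ deg A 0 := by
  refine mem_deg.2 ⟨fun m => ?_, Submodule.zero_mem _⟩
  rw [one_fst, coeff_one]
  split_ifs
  · exact SetLike.one_mem_graded A.deg
  · exact Submodule.zero_mem _

theorem mul_mem {i j : ℕ} {x y : PathAlg A} (hx : x ∈ deg A i) (hy : y ∈ deg A j) :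
    x * y ∈ deg A (i + j) := by
  rw [mem_deg] at *
  refine ⟨mul_polyDeg hx.1 hy.1, Submodule.add_mem _ (mul_polyDegPred hx.1 hy.2) ?_⟩
  rw [tau_polyDeg hy.1, mul_smul_comm]
  refine Submodule.smul_mem _ _ ?_
  have h := comm_polyDegPred hy.1 hx.2
  have h' : x.2 * y.1 = (-1 : ℚ) ^ (j * i + j) • (y.1 * x.2) := by
    rw [h, smul_smul, ← mul_pow]; simp
  rw [h', add_comm i j]
  exact Submodule.smul_mem _ _ (mul_polyDegPred hy.1 hx.2)

theorem mul_comm_deg {i j : ℕ} {x y : PathAlg A} (hx : x ∈ deg A i) (hy : y ∈ deg A j) :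
    x * y = (-1 : ℚ) ^ (i * j) • (y * x) := by
  rw [mem_deg] at *
  have e : ∀ n : ℕ, (-1 : ℚ) ^ n * (-1) ^ n = 1 := fun n => by rw [← mul_pow]; simp
  ext1
  · exact comm_polyDeg hx.1 hy.1
  · rw [mul_snd, smul_snd, mul_snd, tau_polyDeg hx.1, tau_polyDeg hy.1,
      comm_polyDegPred hx.1 hy.2, comm_polyDegPred hy.1 hx.2, mul_smul_comm, mul_smul_comm,
      smul_add, smul_smul, smul_smul, ← pow_add, add_comm]
    congr 2
    · rw [mul_comm j i, pow_add, pow_add, ← mul_assoc, e, one_mul]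
    · rw [pow_add]

/-- The projection onto the component of degree `n`. -/
def proj (A : CGA) : ℕ → PathAlg A →ₗ[ℚ] PathAlg A
  | 0 => LinearMap.prodMap (coeffMap (GradedAlgebra.proj A.deg 0)) 0
  | n + 1 => LinearMap.prodMap (coeffMap (GradedAlgebra.proj A.deg (n + 1)))
      (coeffMap (GradedAlgebra.proj A.deg n))

theorem proj_same {n : ℕ} {p : A.carrier[X]} (hp : p ∈ polyDeg A n) :
    coeffMap (GradedAlgebra.proj A.deg n) p = p := by
  ext m
  rw [coeff_coeffMap, GradedAlgebra.proj_apply, DirectSum.decompose_of_mem_same _ (hp m)]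

theorem proj_ne {n m : ℕ} (h : n ≠ m) {p : A.carrier[X]} (hp : p ∈ polyDeg A m) :
    coeffMap (GradedAlgebra.proj A.deg n) p = 0 := by
  ext l
  rw [coeff_coeffMap, GradedAlgebra.proj_apply, DirectSum.decompose_of_mem_ne _ (hp l) h.symm,
    coeff_zero]

theorem monomial_mem {n : ℕ} {a : A.carrier} (ha : a ∈ A.deg n) (m : ℕ) :
    monomial m a ∈ polyDeg A n := by
  intro l
  rw [coeff_monomial]
  split_ifs
  · exact ha
  · exact Submodule.zero_mem _

theorem iSup_deg : ⨆ n, deg A n = ⊤ := by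
  have h1 : ∀ p : A.carrier[X], mk p 0 ∈ ⨆ n, deg A n := by
    intro p
    induction p using Polynomial.induction_on' with
    | add p q hp hq =>
      have h : (mk (p + q) 0 : PathAlg A) = mk p 0 + mk q 0 := by ext1 <;> simp
      rw [h]
      exact Submodule.add_mem _ hp hq
    | monomial m a =>
      induction a using DirectSum.Decomposition.inductionOn A.deg with
      | zero => rw [map_zero]; exact Submodule.zero_mem _
      | add a b ha hb =>
        have h : (mk (monomial m (a + b)) 0 : PathAlg A) =
            mk (monomial m a) 0 + mk (monomial m b) 0 := by ext1 <;> simp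
        rw [h]
        exact Submodule.add_mem _ ha hb
      | @homogeneous n a =>
        exact Submodule.mem_iSup_of_mem n (mem_deg.2 ⟨monomial_mem a.2 m, Submodule.zero_mem _⟩)
  have h2 : ∀ p : A.carrier[X], mk 0 p ∈ ⨆ n, deg A n := by
    intro p
    induction p using Polynomial.induction_on' with
    | add p q hp hq =>
      have h : (mk 0 (p + q) : PathAlg A) = mk 0 p + mk 0 q := by ext1 <;> simp
      rw [h]
      exact Submodule.add_mem _ hp hq
    | monomial m a =>
      induction a using DirectSum.Decomposition.inductionOn A.deg with
      | zero => rw [map_zero]; exact Submodule.zero_mem _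
      | add a b ha hb =>
        have h : (mk 0 (monomial m (a + b)) : PathAlg A) =
            mk 0 (monomial m a) + mk 0 (monomial m b) := by ext1 <;> simp
        rw [h]
        exact Submodule.add_mem _ ha hb
      | @homogeneous n a =>
        exact Submodule.mem_iSup_of_mem (n + 1) (mem_deg.2 ⟨Submodule.zero_mem _, monomial_mem a.2 m⟩)
  rw [eq_top_iff]
  rintro x -
  have h : x = mk x.1 0 + mk 0 x.2 := by ext1 <;> simp
  rw [h]
  exact Submodule.add_mem _ (h1 _) (h2 _)

theorem isInternal : DirectSum.IsInternal (deg A) := by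
  refine isInternal_of_proj (deg A) (proj A) ?_ ?_ iSup_deg
  · intro n x hx
    rw [mem_deg] at hx
    cases n with
    | zero => exact PathAlg.ext (proj_same hx.1) (show (0 : A.carrier[X]) = x.2 from hx.2.symm)
    | succ n => exact PathAlg.ext (proj_same hx.1) (proj_same (n := n) hx.2)
  · intro n m h x hx
    rw [mem_deg] at hx
    cases n with
    | zero => exact PathAlg.ext (proj_ne h hx.1) rfl
    | succ n =>
      refine PathAlg.ext (proj_ne h hx.1) ?_
      cases m with
      | zero =>
        change coeffMap (GradedAlgebra.proj A.deg n) x.2 = 0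
        rw [show x.2 = 0 from hx.2, map_zero]
      | succ m => exact proj_ne (m := m) (fun e => h (by rw [e])) hx.2

instance : SetLike.GradedMonoid (deg A) where
  one_mem := one_mem
  mul_mem _ _ _ _ ha hb := mul_mem ha hb

instance : GradedAlgebra (deg A) where
  toDecomposition := isInternal.chooseDecomposition

/-- `A ⊗ Λ(t, dt)` as a graded-commutative algebra. -/
def toCGA (A : CGA) : CGA where
  carrier := PathAlg A
  deg := deg A
  comm := mul_comm_deg

/-- `d (p + q dt) = d p + (τ(p') + d q) dt`, where `p'` is the derivative with respect to `t`. -/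
def diff (A : CDGA) : PathAlg A.toCGA →ₗ[ℚ] PathAlg A.toCGA where
  toFun x := mk (coeffMap A.d x.1) (tau (derivative x.1) + coeffMap A.d x.2)
  map_add' x y := by
    refine PathAlg.ext ?_ ?_
    · simp
    · simp only [mk_snd, add_fst, add_snd, map_add]; abel
  map_smul' c x := by
    refine PathAlg.ext ?_ ?_
    · simp
    · simp only [mk_snd, smul_fst, smul_snd, map_smul, derivative_smul, RingHom.id_apply, smul_add]

theorem diff_fst (A : CDGA) (x : PathAlg A.toCGA) : (diff A x).1 = coeffMap A.d x.1 := rfl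
theorem diff_snd (A : CDGA) (x : PathAlg A.toCGA) :
    (diff A x).2 = tau (derivative x.1) + coeffMap A.d x.2 := rfl

theorem coeffMap_d_mul (A : CDGA) (p q : A.carrier[X]) :
    coeffMap A.d (p * q) = coeffMap A.d p * q + tau (A := A.toCGA) p * coeffMap A.d q := by
  ext n
  simp [tau, coeff_coeffMap, coeff_mul, A.d_mul, Finset.sum_add_distrib]

theorem coeffMap_d_d (A : CDGA) (p : A.carrier[X]) : coeffMap A.d (coeffMap A.d p) = 0 := by
  ext n
  simp [coeff_coeffMap, A.d_d]

theorem tau_coeffMap_d (A : CDGA) (p : A.carrier[X]) :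
    tau (A := A.toCGA) (coeffMap A.d p) = -coeffMap A.d (tau (A := A.toCGA) p) := by
  ext n
  simp [tau, coeff_coeffMap, A.sign_d]

theorem coeffMap_d_mem (A : CDGA) {n : ℕ} {p : A.carrier[X]} (hp : p ∈ polyDeg A.toCGA n) :
    coeffMap A.d p ∈ polyDeg A.toCGA (n + 1) := by
  intro m
  rw [coeff_coeffMap]
  exact A.d_mem (hp m)

theorem derivative_mem {n : ℕ} {p : A.carrier[X]} (hp : p ∈ polyDeg A n) :
    derivative p ∈ polyDeg A n := by
  intro m
  rw [coeff_derivative, ← Nat.cast_succ, ← (Nat.cast_commute _ _).eq, ← nsmul_eq_mul]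
  exact Submodule.smul_of_tower_mem _ _ (hp _)

end PathAlg

/-- The CDGA `A ⊗ Λ(t, dt)`. -/
def CDGA.path (A : CDGA) : CDGA where
  toCGA := PathAlg.toCGA A.toCGA
  d := PathAlg.diff A
  d_mem := by
    intro n (x : PathAlg A.toCGA) hx
    have hx : x ∈ PathAlg.deg A.toCGA n := hx
    rw [PathAlg.mem_deg] at hx
    change PathAlg.diff A x ∈ PathAlg.deg A.toCGA (n + 1)
    rw [PathAlg.mem_deg, PathAlg.diff_fst, PathAlg.diff_snd]
    refine ⟨PathAlg.coeffMap_d_mem A hx.1, Submodule.add_mem _ ?_ ?_⟩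
    · change _ ∈ PathAlg.polyDeg A.toCGA n
      rw [PathAlg.tau_polyDeg (PathAlg.derivative_mem hx.1)]
      exact Submodule.smul_mem _ _ (PathAlg.derivative_mem hx.1)
    · cases n with
      | zero => rw [show x.2 = 0 from hx.2, map_zero]; exact Submodule.zero_mem _
      | succ n => exact PathAlg.coeffMap_d_mem A (n := n) hx.2
  d_d := by
    intro (x : PathAlg A.toCGA)
    change PathAlg.diff A (PathAlg.diff A x) = 0
    refine PathAlg.ext (PathAlg.coeffMap_d_d A x.1) ?_
    rw [PathAlg.diff_snd, PathAlg.diff_fst, PathAlg.diff_snd, derivative_coeffMap,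
      PathAlg.tau_coeffMap_d, map_add, PathAlg.coeffMap_d_d, add_zero, neg_add_cancel,
      PathAlg.zero_snd]
  leibniz := by
    intro n (x : PathAlg A.toCGA) (y : PathAlg A.toCGA) hx
    have hx : x ∈ PathAlg.deg A.toCGA n := hx
    rw [PathAlg.mem_deg] at hx
    change PathAlg.diff A (x * y) =
      PathAlg.diff A x * y + (-1 : ℚ) ^ n • (x * PathAlg.diff A y)
    have h1 := PathAlg.tau_polyDeg hx.1
    have h2 := PathAlg.tau_polyDegPred hx.2
    refine PathAlg.ext ?_ ?_
    · simp only [PathAlg.diff_fst, PathAlg.mul_fst, PathAlg.add_fst, PathAlg.smul_fst,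
        PathAlg.coeffMap_d_mul, h1, smul_mul_assoc]
    · simp only [PathAlg.diff_fst, PathAlg.diff_snd, PathAlg.mul_fst, PathAlg.mul_snd,
        PathAlg.add_snd, PathAlg.smul_snd, PathAlg.coeffMap_d_mul, derivative_mul, map_add,
        PathAlg.tau_mul, h1, h2, PathAlg.tau_coeffMap_d, mul_add, add_mul, smul_add,
        smul_mul_assoc, mul_neg, neg_mul, smul_neg]
      abel

namespace CDGA

/-- The evaluation `B ⊗ Λ(t, dt) → B` at `t = c`, `dt = 0`. -/
def evalAt (B : CDGA) (c : ℚ) : B.path.carrier → B.carrier :=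
  fun x : PathAlg B.toCGA => x.1.eval (algebraMap ℚ B.carrier c)

/-- The homotopy relation on morphisms `A → B` (for `A` a Sullivan algebra): `f` and `g` are
homotopic if there is `Φ : A → B ⊗ Λ(t, dt)` that evaluates to `f` at `t = 0` and to `g` at
`t = 1`. -/
def Homotopic {A B : CDGA} (f g : Hom A B) : Prop :=
  ∃ Φ : Hom A B.path, (∀ a, B.evalAt 0 (Φ a) = f a) ∧ (∀ a, B.evalAt 1 (Φ a) = g a)

/-- Homotopy equivalences. -/
def IsHomotopyEquiv {A B : CDGA} (f : Hom A B) : Prop :=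
  ∃ g : Hom B A, Homotopic (g.comp f) (Hom.id A) ∧ Homotopic (f.comp g) (Hom.id B)

/-- `A` is homotopically rigid: every self-homotopy equivalence is homotopic to the identity. -/
def IsHomotopicallyRigid (A : CDGA) : Prop :=
  ∀ f : Hom A A, IsHomotopyEquiv f → Homotopic f (Hom.id A)

/-- `A` is `n`-connected: `H^0(A) = ℚ` and `H^i(A) = 0` for `0 < i ≤ n`. -/
structure IsNConnected (A : CDGA) (n : ℕ) : Prop where
  nontrivial : Nontrivial A.carrier
  zero : ∀ a ∈ A.deg 0, A.d a = 0 → ∃ c : ℚ, a = algebraMap ℚ A.carrier c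
  pos : ∀ i, i + 1 ≤ n → ∀ a ∈ A.deg (i + 1), A.d a = 0 → ∃ b ∈ A.deg i, A.d b = a

/-- `A` is a minimal Sullivan algebra `(ΛW, d)` on the graded subspace `W`. -/
structure IsMinimalSullivan (A : CDGA) (W : ℕ → Submodule ℚ A.carrier) : Prop where
  le_deg : ∀ n, W n ≤ A.deg n
  /-- `W` is simply connected -/
  zero : W 0 = ⊥
  one : W 1 = ⊥
  /-- `W` is of finite type -/
  finite : ∀ n, FiniteDimensional ℚ (W n)
  /-- `A = ΛW` is free on `W` as a graded-commutative algebra -/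
  free : ∀ (B : CGA) (f : ∀ n, W n →ₗ[ℚ] B.carrier), (∀ n x, f n x ∈ B.deg n) →
    ∃! F : CGA.Hom A.toCGA B, ∀ n (x : W n), F.toAlgHom x = f n x
  /-- nilpotence: `W` is the union of graded subspaces `W(0) ⊆ W(1) ⊆ ⋯` with `d W(0) = 0` and
  `d W(j+1) ⊆ ΛW(j)` -/
  nilpotent : ∃ F : ℕ → ℕ → Submodule ℚ A.carrier,
    (∀ n, Monotone fun j => F j n) ∧ (∀ n, ⨆ j, F j n = W n) ∧
    (∀ n, ∀ x ∈ F 0 n, A.d x = 0) ∧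
    (∀ j n, ∀ x ∈ F (j + 1) n, A.d x ∈ Algebra.adjoin ℚ (⋃ m, (F j m : Set A.carrier)))
  /-- minimality: `d W ⊆ Λ^{≥2} W` -/
  minimal : ∀ n, ∀ x ∈ W n, A.d x ∈ ⨆ j, (⨆ m, W m) ^ (j + 2)

end CDGA

/-! ### The algebras `M_k` -/

namespace RigidAlgebra

/-- The generators of `M_k`. -/
inductive Gen
  | x₁ | x₂ | y₁ | y₂ | y₃ | z

/-- The degrees of the generators of `M_k`. -/
def w (k : ℕ) : Gen → ℕ
  | .x₁ => 5 * k - 2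
  | .x₂ => 6 * k - 2
  | .y₁ => 21 * k - 9
  | .y₂ => 22 * k - 9
  | .y₃ => 23 * k - 9
  | .z => 15 * k ^ 2 - 11 * k + 1

/-- The generators as elements of `Λ(x₁, x₂, y₁, y₂, y₃, z)`. -/
abbrev e (k : ℕ) (g : Gen) : FreeCGA (w k) := FreeCGA.gen (w k) g

open Gen in
/-- The differentials of the generators of `M_k`. -/
def v (k : ℕ) : Gen → FreeCGA (w k)
  | x₁ => 0
  | x₂ => 0
  | y₁ => e k x₁ ^ 3 * e k x₂
  | y₂ => e k x₁ ^ 2 * e k x₂ ^ 2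
  | y₃ => e k x₁ * e k x₂ ^ 3
  | z => e k x₁ ^ (3 * k - 12) *
        (e k x₁ ^ 2 * e k y₂ * e k y₃ - e k x₁ * e k x₂ * e k y₁ * e k y₃
          + e k x₂ ^ 2 * e k y₁ * e k y₂)
      + e k x₁ ^ ((6 * k - 2) / 2) + e k x₂ ^ ((5 * k - 2) / 2)

theorem pow_mem {k : ℕ} (g : Gen) (n : ℕ) : e k g ^ n ∈ FreeCGA.deg (w k) (n * w k g) := by
  simpa using SetLike.pow_mem_graded n (FreeCGA.gen_mem (w k) g)

theorem w_values {k : ℕ} (hk : Even k ∧ 4 < k) : ∃ m : ℕ,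
    w k .x₁ = 10 * m + 28 ∧ w k .x₂ = 12 * m + 34 ∧ w k .y₁ = 42 * m + 117 ∧
    w k .y₂ = 44 * m + 123 ∧ w k .y₃ = 46 * m + 129 ∧ w k .z = 60 * m ^ 2 + 338 * m + 475 ∧
    3 * k - 12 = 6 * m + 6 ∧ (6 * k - 2) / 2 = 6 * m + 17 ∧ (5 * k - 2) / 2 = 5 * m + 14 := by
  obtain ⟨⟨r, hr⟩, h4⟩ := hk
  obtain ⟨m, rfl⟩ : ∃ m, r = m + 3 := ⟨r - 3, by omega⟩
  subst hr
  refine ⟨m, ?_, ?_, ?_, ?_, ?_, ?_, ?_, ?_, ?_⟩ <;> try simp only [w]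
  any_goals omega
  have : 15 * (m + 3 + (m + 3)) ^ 2 = 60 * m ^ 2 + 338 * m + 474 + 11 * (m + 3 + (m + 3)) := by
    ring
  omega

theorem mem_of_eq {k m n : ℕ} {a : FreeCGA (w k)} (ha : a ∈ FreeCGA.deg (w k) m) (h : m = n) :
    a ∈ FreeCGA.deg (w k) n := h ▸ ha

theorem v_mem {k : ℕ} (hk : Even k ∧ 4 < k) (g : Gen) :
    v k g ∈ FreeCGA.deg (w k) (w k g + 1) := by
  obtain ⟨m, h1, h2, h3, h4, h5, h6, h7, h8, h9⟩ := w_values hk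
  have g0 := fun g => FreeCGA.gen_mem (w k) g
  cases g with
  | x₁ => exact Submodule.zero_mem _
  | x₂ => exact Submodule.zero_mem _
  | y₁ =>
    refine mem_of_eq (FreeCGA.mul_mem _ (pow_mem .x₁ 3) (g0 .x₂)) ?_
    rw [h1, h2, h3]; ring
  | y₂ =>
    refine mem_of_eq (FreeCGA.mul_mem _ (pow_mem .x₁ 2) (pow_mem .x₂ 2)) ?_
    rw [h1, h2, h4]; ring
  | y₃ =>
    refine mem_of_eq (FreeCGA.mul_mem _ (g0 .x₁) (pow_mem .x₂ 3)) ?_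
    rw [h1, h2, h5]; ring
  | z =>
    simp only [v, h7, h8, h9]
    refine Submodule.add_mem _ (Submodule.add_mem _ ?_ ?_) ?_
    · refine mem_of_eq (FreeCGA.mul_mem _ (n := 110 * m + 308) (pow_mem .x₁ (6 * m + 6))
        (Submodule.add_mem _ (Submodule.sub_mem _ ?_ ?_) ?_)) ?_
      · refine mem_of_eq (FreeCGA.mul_mem _ (FreeCGA.mul_mem _ (pow_mem .x₁ 2) (g0 .y₂))
          (g0 .y₃)) ?_
        omega
      · refine mem_of_eq (FreeCGA.mul_mem _ (FreeCGA.mul_mem _ (FreeCGA.mul_mem _ (g0 .x₁)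
          (g0 .x₂)) (g0 .y₁)) (g0 .y₃)) ?_
        omega
      · refine mem_of_eq (FreeCGA.mul_mem _ (FreeCGA.mul_mem _ (pow_mem .x₂ 2) (g0 .y₁))
          (g0 .y₂)) ?_
        omega
      · rw [h1, h6]; ring
    · refine mem_of_eq (pow_mem .x₁ _) ?_
      rw [h1, h6]; ring
    · refine mem_of_eq (pow_mem .x₂ _) ?_
      rw [h2, h6]; ring

theorem deriv_v {k : ℕ} (hk : Even k ∧ 4 < k) (g : Gen) :
    FreeCGA.deriv (v k) (v_mem hk) (v k g) = 0 := by
  obtain ⟨m, h1, h2, h3, h4, h5, -⟩ := w_values hk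
  set D := FreeCGA.deriv (v k) (v_mem hk) with hD
  have hx1 : Even (w k .x₁) := by rw [h1]; exact ⟨5 * m + 14, by ring⟩
  have hx2 : Even (w k .x₂) := by rw [h2]; exact ⟨6 * m + 17, by ring⟩
  have hy1 : Odd (w k .y₁) := by rw [h3]; exact ⟨21 * m + 58, by ring⟩
  have hy2 : Odd (w k .y₂) := by rw [h4]; exact ⟨22 * m + 61, by ring⟩
  have cent : ∀ g, Even (w k g) → ∀ g', Commute (e k g) (e k g') := fun g hg g' => by
    have := FreeCGA.gen_mul_gen (w k) g g'
    rwa [(hg.mul_right _).neg_one_pow, one_smul] at this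
  have g0 := fun g => FreeCGA.gen_mem (w k) g
  have hgen : ∀ g, D (e k g) = v k g := FreeCGA.deriv_gen _ _
  have even_mul : ∀ g b, Even (w k g) → v k g = 0 → D (e k g * b) = e k g * D b := by
    intro g b hg h0
    rw [hD, FreeCGA.deriv_mul _ _ b (g0 g), ← hD, hgen, h0, hg.neg_one_pow, one_smul, zero_mul,
      zero_add]
  have m1 : ∀ b, D (e k .x₁ * b) = e k .x₁ * D b := fun b => even_mul .x₁ b hx1 rfl
  have m2 : ∀ b, D (e k .x₂ * b) = e k .x₂ * D b := fun b => even_mul .x₂ b hx2 rfl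
  have p1 : ∀ n b, D (e k .x₁ ^ n * b) = e k .x₁ ^ n * D b := by
    intro n b
    induction n with
    | zero => simp
    | succ n ih => rw [pow_succ', mul_assoc, m1, ih, mul_assoc]
  have p2 : ∀ n b, D (e k .x₂ ^ n * b) = e k .x₂ ^ n * D b := by
    intro n b
    induction n with
    | zero => simp
    | succ n ih => rw [pow_succ', mul_assoc, m2, ih, mul_assoc]
  have d1 : D 1 = 0 := FreeCGA.deriv_one _ _
  have q1 : ∀ n, D (e k .x₁ ^ n) = 0 := fun n => by
    have := p1 n 1
    rwa [mul_one, d1, mul_zero] at this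
  have q2 : ∀ n, D (e k .x₂ ^ n) = 0 := fun n => by
    have := p2 n 1
    rwa [mul_one, d1, mul_zero] at this
  have odd_mul : ∀ g g', Odd (w k g) →
      D (e k g * e k g') = v k g * e k g' - e k g * v k g' := by
    intro g g' hg
    rw [hD, FreeCGA.deriv_mul _ _ _ (g0 g), ← hD, hgen, hgen, hg.neg_one_pow, neg_one_smul,
      sub_eq_add_neg]
  cases g with
  | x₁ => exact map_zero _
  | x₂ => exact map_zero _
  | y₁ =>
    change D (e k .x₁ ^ 3 * e k .x₂) = 0
    rw [p1, hgen]; exact mul_zero _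
  | y₂ =>
    change D (e k .x₁ ^ 2 * e k .x₂ ^ 2) = 0
    rw [p1, q2, mul_zero]
  | y₃ =>
    change D (e k .x₁ * e k .x₂ ^ 3) = 0
    rw [m1, q2, mul_zero]
  | z =>
    change D (_ * (_ - _ + _) + _ + _) = 0
    rw [map_add, map_add, q1, q2, add_zero, add_zero, p1, map_add, map_sub]
    simp only [mul_assoc]
    rw [p1, m1, m2, p2, odd_mul _ _ hy2, odd_mul _ _ hy1, odd_mul _ _ hy1]
    simp only [v]
    have c21 := (cent .x₂ hx2 .x₁).eq
    have c1y1 := (cent .x₁ hx1 .y₁).eq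
    have c1y2 := (cent .x₁ hx1 .y₂).eq
    have c2y1 := (cent .x₂ hx2 .y₁).eq
    have c2y2 := (cent .x₂ hx2 .y₂).eq
    generalize e k .x₁ = X at *
    generalize e k .x₂ = Y at *
    generalize e k .y₁ = a at *
    generalize e k .y₂ = b at *
    generalize e k .y₃ = c at *
    have r1 : ∀ t, Y * (X * t) = X * (Y * t) := fun t => by rw [← mul_assoc, c21, mul_assoc]
    have r2 : ∀ t, a * (X * t) = X * (a * t) := fun t => by rw [← mul_assoc, ← c1y1, mul_assoc]
    have r3 : ∀ t, b * (X * t) = X * (b * t) := fun t => by rw [← mul_assoc, ← c1y2, mul_assoc]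
    have r4 : ∀ t, a * (Y * t) = Y * (a * t) := fun t => by rw [← mul_assoc, ← c2y1, mul_assoc]
    have r5 : ∀ t, b * (Y * t) = Y * (b * t) := fun t => by rw [← mul_assoc, ← c2y2, mul_assoc]
    simp only [pow_succ, pow_zero, one_mul, mul_sub, mul_assoc, r1, r2, r3, r4, r5, ← c2y1,
      ← c2y2]
    convert mul_zero _ using 2
    abel

/-- The CDGA `M_k = (Λ(x₁, x₂, y₁, y₂, y₃, z), d)`. -/
def M (k : ℕ) (hk : Even k ∧ 4 < k) : CDGA := FreeCGA.toCDGA (v k) (v_mem hk) (deriv_v hk)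

/-- The zero map of `M_k`. -/
def zeroMap (k : ℕ) (hk : Even k ∧ 4 < k) : CDGA.Hom (M k hk) (M k hk) :=
  FreeCGA.zeroMap (v k) (v_mem hk) (deriv_v hk)

/-- The graded space of generators of `M_k`. -/
def W (k : ℕ) (hk : Even k ∧ 4 < k) (n : ℕ) : Submodule ℚ (M k hk).carrier :=
  Submodule.span ℚ (e k '' {g | w k g = n})

end RigidAlgebra

end

/-! The content lies in the strict self-maps: `M_k` has only two of them, the zero map and the
identity, even before passing to homotopy classes. Every component of `M_k` in the degree of a
generator is spanned by that generator (`exists_smul_e`), so a self-map is diagonal on generators.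
Write `a`, `b` for its eigenvalues on `x₁`, `x₂`. Compatibility with `d` gives eigenvalues `a³b`,
`a²b²`, `ab³` on `y₁`, `y₂`, `y₃`. The three kinds of terms in `dz` then yield, for `k = 2m + 6`,
`a^(6m+17) = b^(5m+14) = a^(6m+11) b^5`. Over `ℚ` this forces `a = b = 0` or `a = b = 1`
(`eigenvalue_cases`), hence `eq_zeroMap_or_eq_id`. The span statement for `z` is arithmetic. With `p
= 5m+14` and `q = 6m+17`, which are coprime, `|x₁| = 2p`, `|x₂| = 2q` and `|z| = 2pq - 1`. A
competing monomial would write `pq` as `up + vq` with `u, v > 0`, which is impossible (`weight_ne`).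
A homotopy cannot move `x₁`: it is a cocycle, and `M_k` vanishes one degree below it
(`Homotopic.apply_eq`). So the zero map and the identity are not homotopic, and homotopy of
self-maps is equality. The same argument separates the `M_k`: for `k < l` a morphism from `M_k` to
`M_l` kills `x₁` for degree reasons, so it has no homotopy inverse. No monomial basis of the free
algebra is needed. Spanning words bound its components from above, and homomorphisms to `ℚ` and to a
matrix algebra (`point`, `exterior`) detect coefficients. -/

noncomputable section

open Polynomial

/-! ### Words in a free graded-commutative algebra -/

namespace FreeCGA

variable {ι : Type} {w : ι → ℕ}

/-- Algebra homomorphisms that agree on the generators are equal. -/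
theorem algHom_ext {B : Type} [Ring B] [Algebra ℚ B] {f g : FreeCGA w →ₐ[ℚ] B}
    (h : ∀ i, f (gen w i) = g (gen w i)) : f = g := by
  have key : f.toLinearMap = g.toLinearMap := by
    refine LinearMap.ext_on_range (span_word w) fun l => ?_
    simp only [AlgHom.toLinearMap_apply]
    induction l with
    | nil => simp
    | cons i l ih => rw [word_cons, map_mul, map_mul, ih, h]
  exact AlgHom.toLinearMap_injective key

/-- The commutation relation of an odd generator with itself reads `e² = -e²`, and 2 is invertible.
-/
theorem gen_mul_self_of_odd {i : ι} (hi : Odd (w i)) : gen w i * gen w i = 0 := by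
  have h := gen_mul_gen w i i
  rw [(hi.mul hi).neg_one_pow, neg_one_smul] at h
  have h2 : (2 : ℚ) • (gen w i * gen w i) = 0 := by
    rw [two_smul]; exact eq_neg_iff_add_eq_zero.1 h
  exact (smul_eq_zero.1 h2).resolve_left two_ne_zero

/-- Up to sign the letter can be moved next to its other occurrence, where its square vanishes. -/
theorem gen_mul_word_of_mem {i : ι} (hi : Odd (w i)) {l : List ι} (hl : i ∈ l) :
    gen w i * word w l = 0 := by
  obtain ⟨s, t, rfl⟩ := List.append_of_mem hl
  rw [word_append, word_cons, ← mul_assoc, gen_mul_word, smul_mul_assoc, mul_assoc,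
    ← mul_assoc (gen w i), gen_mul_self_of_odd hi, zero_mul, mul_zero, smul_zero]

theorem word_eq_zero_of_count [DecidableEq ι] {i : ι} (hi : Odd (w i)) {l : List ι}
    (hl : 2 ≤ l.count i) : word w l = 0 := by
  induction l with
  | nil => simp at hl
  | cons j l ih =>
    rw [word_cons]
    by_cases hj : j = i
    · subst hj
      rw [List.count_cons_self] at hl
      exact gen_mul_word_of_mem hi (List.count_pos_iff.1 (by omega))
    · rw [List.count_cons_of_ne hj] at hl
      rw [ih hl, mul_zero]

/-- If the words of weight `w i` that do not vanish are all equal to `[i]`, then `gen w i` spans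
the component of degree `w i`. -/
theorem exists_smul_gen {i : ι} (h : ∀ l, wt w l = w i → word w l = 0 ∨ l = [i])
    {a : FreeCGA w} (ha : a ∈ deg w (w i)) : ∃ c : ℚ, a = c • gen w i := by
  have : deg w (w i) ≤ Submodule.span ℚ {gen w i} := by
    refine Submodule.span_le.2 ?_
    rintro _ ⟨l, hl, rfl⟩
    rcases h l hl with h0 | rfl
    · rw [h0]; exact Submodule.zero_mem _
    · simp
  obtain ⟨c, hc⟩ := Submodule.mem_span_singleton.1 (this ha)
  exact ⟨c, hc.symm⟩

theorem exists_mem_odd_of_odd_wt {l : List ι} (hl : Odd (wt w l)) : ∃ i ∈ l, Odd (w i) := by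
  by_contra! h
  refine (Nat.not_odd_iff_even.2 ?_) hl
  induction l with
  | nil => simp
  | cons i l ih =>
    simp only [List.mem_cons, forall_eq_or_imp, Nat.not_odd_iff_even] at h
    rw [wt_cons] at hl ⊢
    have he : Even (wt w l) := by
      by_contra hne
      exact hne (ih (Nat.not_even_iff_odd.1 hne)
        (fun j hj => Nat.not_odd_iff_even.2 (h.2 j hj)))
    exact h.1.add he

theorem le_wt_of_ne_nil {N : ℕ} (hN : ∀ i, N ≤ w i) {l : List ι} (hl : l ≠ []) : N ≤ wt w l := by
  cases l with
  | nil => exact absurd rfl hl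
  | cons i l => rw [wt_cons]; exact (hN i).trans (Nat.le_add_right _ _)

/-- A word that contains the letter `i` is either `[i]` or heavier than `w i` by at least `N`. -/
theorem eq_singleton_or_le_wt {N : ℕ} (hN : ∀ i, N ≤ w i) {i : ι} {l : List ι} (hl : i ∈ l) :
    l = [i] ∨ w i + N ≤ wt w l := by
  obtain ⟨s, t, rfl⟩ := List.append_of_mem hl
  rw [wt_append, wt_cons]
  rcases eq_or_ne s [] with rfl | hs
  · rcases eq_or_ne t [] with rfl | ht
    · exact Or.inl rfl
    · have := le_wt_of_ne_nil hN ht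
      exact Or.inr (by omega)
  · have := le_wt_of_ne_nil hN hs
    exact Or.inr (by omega)

theorem deg_eq_bot {N : ℕ} (hN : ∀ i, N ≤ w i) {n : ℕ} (h0 : n ≠ 0) (hn : n < N) :
    deg w n = ⊥ := by
  rw [eq_bot_iff]
  refine Submodule.span_le.2 ?_
  rintro _ ⟨l, hl, rfl⟩
  have : l ≠ [] := by rintro rfl; exact h0 hl.symm
  have := le_wt_of_ne_nil hN this
  omega

theorem exists_algebraMap_of_mem_deg_zero (hw : ∀ i, 0 < w i) {a : FreeCGA w}
    (ha : a ∈ deg w 0) : ∃ c : ℚ, a = algebraMap ℚ (FreeCGA w) c := by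
  have : deg w 0 ≤ Submodule.span ℚ {1} := by
    refine Submodule.span_le.2 ?_
    rintro _ ⟨l, hl, rfl⟩
    have : l = [] := by
      by_contra h
      have := le_wt_of_ne_nil (N := 1) hw h
      omega
    subst this
    exact Submodule.mem_span_singleton_self _
  obtain ⟨c, hc⟩ := Submodule.mem_span_singleton.1 (this ha)
  exact ⟨c, by rw [← hc, Algebra.algebraMap_eq_smul_one]⟩

end FreeCGA

/-! ### Homotopies and cocycles in the path object -/

namespace CDGA

theorem Hom.ext_apply {A B : CDGA} {f g : Hom A B} (h : ∀ a, f a = g a) : f = g := by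
  obtain ⟨f, _, _⟩ := f
  obtain ⟨g, _, _⟩ := g
  obtain rfl : f = g := AlgHom.ext h
  rfl

/-- The inclusion of `A` into `A ⊗ Λ(t, dt)` as the constants. -/
def constAlgHom (A : CGA) : A.carrier →ₐ[ℚ] PathAlg A where
  toFun a := PathAlg.mk (C a) 0
  map_one' := rfl
  map_mul' a b := PathAlg.ext (by simp) (by simp)
  map_zero' := PathAlg.ext (by simp) (by simp)
  map_add' a b := PathAlg.ext (by simp) (by simp)
  commutes' c := by
    rw [Algebra.algebraMap_eq_smul_one, Algebra.algebraMap_eq_smul_one]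
    exact PathAlg.ext (smul_C c (1 : A.carrier)).symm (smul_zero c).symm

/-- The inclusion of the constants as a morphism of CDGAs. -/
def const (A : CDGA) : Hom A A.path where
  toAlgHom := constAlgHom A.toCGA
  map_deg := fun {n a} ha => PathAlg.mem_deg.2
    ⟨PathAlg.monomial_mem (A := A.toCGA) ha 0, Submodule.zero_mem _⟩
  map_d := fun a => PathAlg.ext (coeffMap_monomial A.d 0 a).symm
    (show (0 : A.carrier[X]) = PathAlg.tau (A := A.toCGA) (derivative (C a)) + coeffMap A.d 0 by
      simp)

theorem evalAt_const (A : CDGA) (c : ℚ) (a : A.carrier) : A.evalAt c (A.const a) = a :=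
  eval_C

theorem Homotopic.refl {A B : CDGA} (f : Hom A B) : Homotopic f f :=
  ⟨B.const.comp f, fun a => B.evalAt_const 0 (f a), fun a => B.evalAt_const 1 (f a)⟩

/-- A cocycle of degree `n + 1` in `B ⊗ Λ(t, dt)` is constant if `B` vanishes in degree `n`. -/
theorem path_cocycle_eq_C {B : CDGA} {n : ℕ} (hB : B.deg n = ⊥) {x : PathAlg B.toCGA}
    (hdeg : x ∈ PathAlg.deg B.toCGA (n + 1)) (hdiff : PathAlg.diff B x = 0) :
    x.1 = C (x.1.coeff 0) := by
  rw [PathAlg.mem_deg] at hdeg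
  -- The `dt`-part has coefficients in `B^n`, which is zero.
  have hq : x.2 = 0 := by
    ext m
    have : x.2.coeff m ∈ B.deg n := hdeg.2 m
    rw [hB] at this
    rw [coeff_zero]; exact this
  -- With no `dt`-part in `x`, the `dt`-part of its differential is the derivative in `t` up to
  -- sign.
  have hp : derivative x.1 = 0 := by
    have h2 := congrArg (fun y : PathAlg B.toCGA => y.2) hdiff
    simp only [PathAlg.diff_snd, hq, map_zero, add_zero, PathAlg.zero_snd,
      PathAlg.tau_polyDeg (PathAlg.derivative_mem hdeg.1)] at h2
    exact (smul_eq_zero.1 h2).resolve_left (pow_ne_zero _ (by norm_num))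
  ext m
  rw [coeff_C]
  split_ifs with hm
  · rw [hm]
  · obtain ⟨m, rfl⟩ := Nat.exists_eq_succ_of_ne_zero hm
    have h3 := congrArg (fun y => coeff y m) hp
    simp only [coeff_derivative, coeff_zero] at h3
    -- The coefficient of index `m + 1` is killed by the nonzero integer `m + 1`, hence is zero over
    -- `ℚ`.
    rw [← Nat.cast_succ, ← (Nat.cast_commute _ _).eq, ← nsmul_eq_mul,
      ← Nat.cast_smul_eq_nsmul ℚ] at h3
    exact (smul_eq_zero.1 h3).resolve_left (Nat.cast_ne_zero.2 (Nat.succ_ne_zero m))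

/-- Homotopic morphisms agree on the cocycles of degree `n + 1` if the target vanishes in
degree `n`. -/
theorem Homotopic.apply_eq {A B : CDGA} {f g : Hom A B} (h : Homotopic f g) {n : ℕ}
    (hB : B.deg n = ⊥) {a : A.carrier} (ha : a ∈ A.deg (n + 1)) (hd : A.d a = 0) : f a = g a := by
  obtain ⟨Φ, h0, h1⟩ := h
  -- The homotopy sends the cocycle `a` to a cocycle, so its value is constant in `t` and the two
  -- evaluations coincide.
  have hc := path_cocycle_eq_C hB (x := Φ a) (Φ.map_deg ha)
    ((Φ.map_d a).symm.trans ((congrArg Φ.toAlgHom hd).trans (map_zero Φ.toAlgHom)))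
  have key : ∀ c, B.evalAt c (Φ a) = (Φ a : PathAlg B.toCGA).1.coeff 0 := fun c =>
    (congrArg (Polynomial.eval (algebraMap ℚ B.carrier c)) hc).trans eval_C
  rw [← h0, ← h1, key, key]

end CDGA

/-! ### Degree arithmetic: the components in the degrees of the generators -/

namespace RigidAlgebra

variable {k : ℕ}

theorem le_w (hk : Even k ∧ 4 < k) (g : Gen) : 5 * k - 2 ≤ w k g := by
  obtain ⟨m, h1, h2, h3, h4, h5, h6, -⟩ := w_values hk
  have h : 5 * k - 2 = w k .x₁ := rfl
  rw [h, h1]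
  cases g
  · rw [h1]
  · omega
  · omega
  · omega
  · omega
  · rw [h6]; nlinarith [sq_nonneg m]

instance : DecidableEq Gen := Classical.decEq _

/-- Turns the search for words of a given degree into a Diophantine equation in the letter counts.
-/
theorem wt_eq_sum_count (l : List Gen) :
    FreeCGA.wt (w k) l = l.count .x₁ * w k .x₁ + l.count .x₂ * w k .x₂ + l.count .y₁ * w k .y₁
      + l.count .y₂ * w k .y₂ + l.count .y₃ * w k .y₃ + l.count .z * w k .z := by
  induction l with
  | nil => simp
  | cons g l ih =>
    rw [FreeCGA.wt_cons, ih]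
    cases g <;> simp <;> ring

/-- No product of `x₁`, `x₂` and of distinct elements among `y₁`, `y₂`, `y₃` has the degree
of `z`. -/
theorem weight_ne {m a b c₁ c₂ c₃ : ℕ} (h1 : c₁ ≤ 1) (h2 : c₂ ≤ 1) (h3 : c₃ ≤ 1) :
    a * (10 * m + 28) + b * (12 * m + 34) + c₁ * (42 * m + 117) + c₂ * (44 * m + 123)
      + c₃ * (46 * m + 129) ≠ 60 * m ^ 2 + 338 * m + 475 := by
  intro h
  -- With `p = 5m+14` and `q = 6m+17` the degrees are `|x₁| = 2p`, `|x₂| = 2q`, `|z| = 2pq - 1`, and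
  -- `5q - 6p = 1`.
  have cop : Nat.Coprime (5 * m + 14) (6 * m + 17) := by
    have : IsCoprime ((5 * m + 14 : ℕ) : ℤ) ((6 * m + 17 : ℕ) : ℤ) :=
      ⟨-6, 5, by push_cast; ring⟩
    exact Nat.isCoprime_iff_coprime.1 this
  have key : ∀ α β : ℕ, α ≠ 0 → β ≠ 0 →
      (a + α) * (5 * m + 14) + (b + β) * (6 * m + 17) ≠ (5 * m + 14) * (6 * m + 17) :=
    fun α β hα hβ => Nat.Coprime.mul_add_mul_ne_mul cop (by omega) (by omega)
  -- The degree of `z` is odd, so an even number of `y`'s is excluded by parity. For a single `y`,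
  -- the pair given to `key` is the bidegree of its differential: `|y₁| + 1 = 2(3p + q)`, `|y₂| + 1
  -- = 2(2p + 2q)`, `|y₃| + 1 = 2(p + 3q)`.
  interval_cases c₁ <;> interval_cases c₂ <;> interval_cases c₃
  · ring_nf at h; omega
  · exact key 1 3 (by simp) (by simp) (by nlinarith)
  · exact key 2 2 (by simp) (by simp) (by nlinarith)
  · ring_nf at h; omega
  · exact key 3 1 (by simp) (by simp) (by nlinarith)
  · ring_nf at h; omega
  · ring_nf at h; omega
  -- For `y₁y₂y₃` the degrees add up to `2(6p + 6q) - 3`, so the equation becomes `ap + bq + 6p + 6q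
  -- - 1 = pq`. Since `1 = 5q - 6p`, the extra summand `6p + 6q - 1` equals `12p + q`.
  · exact key 12 1 (by simp) (by simp) (by nlinarith)

/-- The component of `M_k` in the degree of a generator is spanned by that generator. -/
theorem exists_smul_e (hk : Even k ∧ 4 < k) (g : Gen) {a : FreeCGA (w k)}
    (ha : a ∈ FreeCGA.deg (w k) (w k g)) : ∃ c : ℚ, a = c • e k g := by
  refine FreeCGA.exists_smul_gen (fun l hl => ?_) ha
  obtain ⟨m, h1, h2, h3, h4, h5, h6, -⟩ := w_values hk
  have hN : ∀ g, 10 * m + 28 ≤ w k g := fun g => h1 ▸ le_w hk g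
  have hz : 46 * m + 129 < w k .z := by rw [h6]; nlinarith [sq_nonneg m]
  -- For the `y`'s: a word of odd degree has an odd letter, of degree at least `|y₁|`. One more
  -- letter would add at least `|x₁|` and exceed `|y₃|`.
  have odd_case : Odd (w k g) → w k g ≤ 46 * m + 129 → l = [g] := by
    intro ho hle
    obtain ⟨g', hg', ho'⟩ := FreeCGA.exists_mem_odd_of_odd_wt (hl ▸ ho)
    have hlow : 42 * m + 117 ≤ w k g' := by
      rcases g' with _ | _ | _ | _ | _ | _
      · rw [h1] at ho'; obtain ⟨r, hr⟩ := ho'; omega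
      · rw [h2] at ho'; obtain ⟨r, hr⟩ := ho'; omega
      all_goals omega
    rcases FreeCGA.eq_singleton_or_le_wt hN hg' with rfl | hle'
    · simp only [FreeCGA.wt_cons, FreeCGA.wt_nil, add_zero] at hl
      congr 1
      rw [Nat.odd_iff] at ho
      cases g <;> cases g' <;> first | rfl | omega
    · omega
  -- For `x₁` and `x₂`: any word with two letters has degree at least `2|x₁|`, which exceeds `|x₂|`.
  have even_case : w k g ≤ 12 * m + 34 → l = [g] := by
    intro hle
    cases l with
    | nil => have := hN g; simp at hl; omega
    | cons g' l =>
      rcases FreeCGA.eq_singleton_or_le_wt hN (List.mem_cons_self (a := g') (l := l)) with h | h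
      · rw [h] at hl ⊢
        simp only [FreeCGA.wt_cons, FreeCGA.wt_nil, add_zero] at hl
        congr 1
        cases g <;> cases g' <;> first | rfl | omega
      · have := hN g'; omega
  cases g with
  | x₁ => exact Or.inr (even_case (by omega))
  | x₂ => exact Or.inr (even_case (by omega))
  | y₁ => exact Or.inr (odd_case (by rw [h3]; exact ⟨21 * m + 58, by ring⟩) (by omega))
  | y₂ => exact Or.inr (odd_case (by rw [h4]; exact ⟨22 * m + 61, by ring⟩) (by omega))
  | y₃ => exact Or.inr (odd_case (by rw [h5]; exact ⟨23 * m + 64, by ring⟩) (by omega))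
  | z =>
    by_cases hmem : Gen.z ∈ l
    · rcases FreeCGA.eq_singleton_or_le_wt hN hmem with h | h
      · exact Or.inr h
      · omega
    -- A nonzero word without `z` contains each odd letter at most once, so `weight_ne` applies to
    -- its letter counts.
    · refine Or.inl ?_
      by_contra hne
      have hy : ∀ g, Odd (w k g) → l.count g ≤ 1 := by
        intro g hg
        by_contra hc
        exact hne (FreeCGA.word_eq_zero_of_count hg (by omega))
      rw [wt_eq_sum_count, List.count_eq_zero_of_not_mem hmem, zero_mul, add_zero, h1, h2, h3, h4,
        h5, h6] at hl
      exact weight_ne (hy _ (by rw [h3]; exact ⟨21 * m + 58, by ring⟩))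
        (hy _ (by rw [h4]; exact ⟨22 * m + 61, by ring⟩))
        (hy _ (by rw [h5]; exact ⟨23 * m + 64, by ring⟩)) hl

/-! ### Test homomorphisms -/

theorem even_w_x₁ (hk : Even k ∧ 4 < k) : Even (w k .x₁) := by
  obtain ⟨m, h1, -⟩ := w_values hk
  rw [h1]; exact ⟨5 * m + 14, by ring⟩

theorem even_w_x₂ (hk : Even k ∧ 4 < k) : Even (w k .x₂) := by
  obtain ⟨m, -, h2, -⟩ := w_values hk
  rw [h2]; exact ⟨6 * m + 17, by ring⟩

/-- The values of the evaluation at `x₁ = s`, `x₂ = t`, `y₁ = y₂ = y₃ = z = 0`. -/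
def pointValue (s t : ℚ) : Gen → ℚ
  | .x₁ => s
  | .x₂ => t
  | _ => 0

/-- The evaluation at `x₁ = s`, `x₂ = t`, `y₁ = y₂ = y₃ = z = 0`. -/
def point (hk : Even k ∧ 4 < k) (s t : ℚ) : FreeCGA (w k) →ₐ[ℚ] ℚ :=
  FreeCGA.lift (w k) (pointValue s t) (fun i j => by
    have hx1 := even_w_x₁ hk
    have hx2 := even_w_x₂ hk
    cases i <;> cases j <;>
      simp [pointValue, (hx1.mul_right _).neg_one_pow, (hx2.mul_right _).neg_one_pow, mul_comm])

theorem point_e (hk : Even k ∧ 4 < k) (s t : ℚ) (g : Gen) :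
    point hk s t (e k g) = pointValue s t g := FreeCGA.lift_gen ..

/-- Left multiplications by the generators of the exterior algebra on `y₂`, `y₃`, and the
identity for `x₁`. -/
def exteriorValue : Gen → Matrix (Fin 4) (Fin 4) ℚ
  | .x₁ => 1
  -- The basis is `1, y₂, y₃, y₂y₃`; the entry `-1` in the next matrix is `y₃y₂ = -y₂y₃`.
  | .y₂ => !![0, 0, 0, 0; 1, 0, 0, 0; 0, 0, 0, 0; 0, 0, 1, 0]
  | .y₃ => !![0, 0, 0, 0; 0, 0, 0, 0; 1, 0, 0, 0; 0, -1, 0, 0]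
  | _ => 0

/-- The homomorphism with `x₁ ↦ 1` and `x₂, y₁, z ↦ 0` onto the exterior algebra on `y₂`, `y₃`,
in its regular representation. -/
def exterior (hk : Even k ∧ 4 < k) : FreeCGA (w k) →ₐ[ℚ] Matrix (Fin 4) (Fin 4) ℚ :=
  FreeCGA.lift (w k) exteriorValue (fun i j => by
    have hx1 := even_w_x₁ hk
    obtain ⟨m, -, -, -, h4, h5, -⟩ := w_values hk
    have o2 : Odd (w k .y₂) := by rw [h4]; exact ⟨22 * m + 61, by ring⟩
    have o3 : Odd (w k .y₃) := by rw [h5]; exact ⟨23 * m + 64, by ring⟩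
    have e22 := (o2.mul o2).neg_one_pow (α := ℚ)
    have e23 := (o2.mul o3).neg_one_pow (α := ℚ)
    have e32 := (o3.mul o2).neg_one_pow (α := ℚ)
    have e33 := (o3.mul o3).neg_one_pow (α := ℚ)
    cases i <;> cases j <;>
      simp [exteriorValue, (hx1.mul_right _).neg_one_pow, (hx1.mul_left _).neg_one_pow,
        e22, e23, e32, e33]
    all_goals
      funext r
      fin_cases r <;> rfl)

theorem exterior_e (hk : Even k ∧ 4 < k) (g : Gen) :
    exterior hk (e k g) = exteriorValue g := FreeCGA.lift_gen ..

/-- The relations do not collapse `x₁`, because evaluation at `x₁ = 1` respects them. -/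
theorem e_x₁_ne_zero (hk : Even k ∧ 4 < k) : e k .x₁ ≠ 0 := by
  intro h
  have := point_e hk 1 0 .x₁
  rw [h, map_zero] at this
  exact zero_ne_one this

/-! ### The self-maps of `M_k` -/

theorem hom_ext {k : ℕ} {hk : Even k ∧ 4 < k} {B : CDGA} {f f' : CDGA.Hom (M k hk) B}
    (h : ∀ g, f (e k g) = f' (e k g)) : f = f' :=
  CDGA.Hom.ext_apply fun a =>
    DFunLike.congr_fun (FreeCGA.algHom_ext (f := f.toAlgHom) (g := f'.toAlgHom) h) a

theorem d_e (hk : Even k ∧ 4 < k) (g : Gen) : (M k hk).d (e k g) = v k g :=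
  FreeCGA.deriv_gen (v k) (v_mem hk) g

theorem zeroMap_e (hk : Even k ∧ 4 < k) (g : Gen) : zeroMap k hk (e k g) = 0 := by
  change algebraMap ℚ (FreeCGA (w k)) (FreeCGA.aug (w k) (FreeCGA.gen (w k) g)) = 0
  rw [FreeCGA.aug, FreeCGA.lift_gen, map_zero]

/-- The solutions of the equations satisfied by the eigenvalues of a self-map. -/
theorem eigenvalue_cases {m : ℕ} {a b : ℚ} (h1 : a ^ (6 * m + 17) = b ^ (5 * m + 14))
    (h2 : a ^ (6 * m + 11) * b ^ 5 = a ^ (6 * m + 17)) : (a = 0 ∧ b = 0) ∨ (a = 1 ∧ b = 1) := by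
  rcases eq_or_ne a 0 with rfl | ha
  · rw [zero_pow (by omega)] at h1
    exact Or.inl ⟨rfl, eq_zero_of_pow_eq_zero h1.symm⟩
  · right
    -- Cancel `a^(6m+11)`.
    have h65 : b ^ 5 = a ^ 6 := by
      rw [show 6 * m + 17 = 6 * m + 11 + 6 by ring, pow_add a (6 * m + 11) 6] at h2
      exact mul_left_cancel₀ (pow_ne_zero _ ha) h2
    have hb : b ≠ 0 := by
      rintro rfl
      rw [zero_pow (by norm_num)] at h65
      exact ha (eq_zero_of_pow_eq_zero h65.symm)
    -- Raising `b^5 = a^6` to the power `m + 3` makes both exponents exceed those of `h1` by exactly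
    -- one, so cancelling gives `b = a`, recorded here for squares.
    have hsq : a ^ 2 = b ^ 2 := by
      have e1 : (a ^ 6) ^ (m + 3) = a ^ (6 * m + 17) * a := by ring
      have e2 : (b ^ 5) ^ (m + 3) = b ^ (5 * m + 14) * b := by ring
      have : b ^ (5 * m + 14) * b = b ^ (5 * m + 14) * a := by rw [← e2, h65, e1, h1]
      rw [mul_left_cancel₀ (pow_ne_zero _ hb) this]
    -- Equal squares give `b^6 = a^6 = b^5`.
    have hb1 : b = 1 := by
      have : b ^ 5 * b = b ^ 5 * 1 := by
        rw [mul_one, show b ^ 5 * b = (b ^ 2) ^ 3 by ring, ← hsq, h65]; ring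
      exact mul_left_cancel₀ (pow_ne_zero _ hb) this
    subst hb1
    rw [one_pow] at h1
    refine ⟨?_, rfl⟩
    -- The exponent is odd, so `a² = 1` reduces the power to `a` itself.
    have e1 : a ^ (6 * m + 17) = (a ^ 2) ^ (3 * m + 8) * a := by ring
    rw [e1, hsq, one_pow, one_pow, one_mul] at h1
    exact h1

/-- The only self-maps of `M_k` are the zero map and the identity. -/
theorem eq_zeroMap_or_eq_id (hk : Even k ∧ 4 < k) (f : CDGA.Hom (M k hk) (M k hk)) :
    f = zeroMap k hk ∨ f = CDGA.Hom.id (M k hk) := by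
  obtain ⟨F, hF⟩ : ∃ F : FreeCGA (w k) →ₐ[ℚ] FreeCGA (w k), F = f.toAlgHom := ⟨_, rfl⟩
  have hc : ∀ g, ∃ c : ℚ, F (e k g) = c • e k g := fun g => by
    rw [hF]; exact exists_smul_e hk g (f.map_deg (FreeCGA.gen_mem (w k) g))
  choose c hc using hc
  -- Commutation with `d` makes each differential an eigenvector with the eigenvalue of its
  -- generator.
  have hv : ∀ g, F (v k g) = c g • v k g := fun g => by
    have h1 := f.map_d (e k g)
    have h2 : f (e k g) = c g • e k g := by rw [← hc, hF]; rfl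
    rw [hF]
    refine (congrArg f.toAlgHom (d_e hk g)).symm.trans (h1.trans ?_)
    refine (congrArg (M k hk).d h2).trans ?_
    exact ((M k hk).d.map_smul (c g) (e k g)).trans (congrArg (c g • ·) (d_e hk g))
  obtain ⟨m, -, -, -, -, -, -, h7, h8, h9⟩ := w_values hk
  -- Setting `x₁ = x₂ = 1` reads off the eigenvalues of the `y`'s as `a³b`, `a²b²`, `ab³`. The
  -- points `(1, 0)` and `(0, 1)` isolate the two pure powers in `dz`.
  have hy1 := congrArg (point hk 1 1) (hv .y₁)
  have hy2 := congrArg (point hk 1 1) (hv .y₂)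
  have hy3 := congrArg (point hk 1 1) (hv .y₃)
  have hz1 := congrArg (point hk 1 0) (hv .z)
  have hz2 := congrArg (point hk 0 1) (hv .z)
  -- The entry in row 3, column 0 is the coefficient of `y₂y₃`. Since `x₂` and `y₁` go to zero and
  -- the pure power of `x₁` goes to the identity matrix, only the term with `x₁² y₂ y₃` survives.
  have hz3 := congrFun (congrFun (congrArg (exterior hk) (hv .z)) 3) 0
  simp only [v, h7, h8, h9, map_add, map_sub, map_mul, map_pow, map_smul, hc, point_e,
    pointValue, smul_eq_mul, mul_one, mul_zero, one_pow, add_zero, sub_zero, zero_add, ne_eq,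
    Nat.add_eq_zero_iff, OfNat.ofNat_ne_zero, and_false, not_false_eq_true, zero_pow]
    at hy1 hy2 hy3 hz1 hz2
  simp [v, h7, h8, h9, hc, exterior_e, exteriorValue, _root_.smul_pow] at hz3
  -- The eigenvalue on `z` is `a^(6m+8)` times those on `y₂` and `y₃`, that is `a^(6m+8) · a²b² ·
  -- ab³ = a^(6m+11) b^5`.
  have hcases := eigenvalue_cases (m := m) (hz1.trans hz2.symm) (by
    rw [hz1, ← hz3, ← hy2, ← hy3]; ring)
  have hfe : ∀ g, f (e k g) = c g • e k g := fun g => by rw [← hc, hF]; rfl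
  rcases hcases with ⟨ha, hb⟩ | ⟨ha, hb⟩
  · left
    rw [ha, hb] at hy1 hy2 hy3
    rw [ha] at hz1
    refine hom_ext fun g => ?_
    rw [hfe, zeroMap_e]
    have hg : c g = 0 := by
      cases g
      · exact ha
      · exact hb
      · simpa using hy1.symm
      · simpa using hy2.symm
      · simpa using hy3.symm
      · simpa using hz1.symm
    rw [hg]
    exact zero_smul ℚ (e k g)
  · right
    rw [ha, hb] at hy1 hy2 hy3
    rw [ha] at hz1
    refine hom_ext fun g => ?_
    have hg : c g = 1 := by
      cases g
      · exact ha
      · exact hb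
      · simpa using hy1.symm
      · simpa using hy2.symm
      · simpa using hy3.symm
      · simpa using hz1.symm
    rw [hfe, hg]
    exact one_smul ℚ (e k g)

/-! ### Homotopy classes of self-maps, rigidity and connectivity -/

theorem deg_eq_bot (hk : Even k ∧ 4 < k) {n : ℕ} (h0 : n ≠ 0) (hn : n < 5 * k - 2) :
    (M k hk).deg n = ⊥ := FreeCGA.deg_eq_bot (le_w hk) h0 hn

/-- The cocycle `x₁` has degree `5k - 2`, and `M_k` vanishes in the positive degree `5k - 3`, so a
homotopy is constant on it. -/
theorem apply_x₁_eq_of_homotopic (hk : Even k ∧ 4 < k) {f g : CDGA.Hom (M k hk) (M k hk)}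
    (h : CDGA.Homotopic f g) : f (e k .x₁) = g (e k .x₁) := by
  have hmem : e k .x₁ ∈ (M k hk).deg (5 * k - 3 + 1) := by
    have := FreeCGA.gen_mem (w k) .x₁
    rwa [show w k .x₁ = 5 * k - 3 + 1 from show 5 * k - 2 = _ by omega] at this
  exact h.apply_eq (deg_eq_bot hk (by omega) (by omega)) hmem (d_e hk .x₁)

/-- The single obstruction behind three facts: the zero map differs from the identity up to
homotopy, it is not an equivalence, and different `M_k` are not equivalent. -/
theorem not_homotopic_id_of_apply_eq_zero (hk : Even k ∧ 4 < k)
    {f : CDGA.Hom (M k hk) (M k hk)} (hf : f (e k .x₁) = 0) :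
    ¬ CDGA.Homotopic f (CDGA.Hom.id (M k hk)) := fun h =>
  e_x₁_ne_zero hk ((apply_x₁_eq_of_homotopic hk h).symm.trans hf)

theorem zeroMap_ne_id (hk : Even k ∧ 4 < k) : zeroMap k hk ≠ CDGA.Hom.id (M k hk) := fun h =>
  not_homotopic_id_of_apply_eq_zero hk (zeroMap_e hk .x₁) (h ▸ CDGA.Homotopic.refl _)

/-- Homotopic self-maps of `M_k` are equal. -/
theorem homotopic_iff_eq (hk : Even k ∧ 4 < k) {f g : CDGA.Hom (M k hk) (M k hk)} :
    CDGA.Homotopic f g ↔ f = g := by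
  refine ⟨fun h => ?_, fun h => h ▸ CDGA.Homotopic.refl _⟩
  have hx := apply_x₁_eq_of_homotopic hk h
  rcases eq_zeroMap_or_eq_id hk f with rfl | rfl <;> rcases eq_zeroMap_or_eq_id hk g with rfl | rfl
  · rfl
  · exact absurd (hx.symm.trans (zeroMap_e hk .x₁)) (e_x₁_ne_zero hk)
  · exact absurd (hx.trans (zeroMap_e hk .x₁)) (e_x₁_ne_zero hk)
  · rfl

/-- Only the zero map has to be excluded, and any composite with it kills `x₁`. -/
theorem isHomotopicallyRigid (hk : Even k ∧ 4 < k) : (M k hk).IsHomotopicallyRigid := by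
  rintro f ⟨g, hgf, -⟩
  rw [homotopic_iff_eq]
  refine (eq_zeroMap_or_eq_id hk f).resolve_left ?_
  rintro rfl
  exact not_homotopic_id_of_apply_eq_zero hk
    ((congrArg g.toAlgHom (zeroMap_e hk .x₁)).trans (map_zero g.toAlgHom)) hgf

/-- If `k < l`, then `M_l` vanishes in the degree `5k - 2` of `x₁`, so the composite through `M_l`
kills `x₁`. A one-sided homotopy inverse suffices. -/
theorem le_of_isHomotopyEquiv {l : ℕ} (hk : Even k ∧ 4 < k) (hl : Even l ∧ 4 < l)
    (f : CDGA.Hom (M k hk) (M l hl)) (g : CDGA.Hom (M l hl) (M k hk))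
    (h : CDGA.Homotopic (g.comp f) (CDGA.Hom.id (M k hk))) : l ≤ k := by
  by_contra hlt
  have hf : f (e k .x₁) ∈ (M l hl).deg (5 * k - 2) := f.map_deg (FreeCGA.gen_mem (w k) .x₁)
  rw [deg_eq_bot hl (by omega) (by omega), Submodule.mem_bot] at hf
  exact not_homotopic_id_of_apply_eq_zero hk
    ((congrArg g.toAlgHom hf).trans (map_zero g.toAlgHom)) h

/-- The algebra itself, not only its cohomology, vanishes in positive degrees below `5k - 2`. -/
theorem isNConnected (hk : Even k ∧ 4 < k) {n : ℕ} (hn : n ≤ 5 * k - 3) :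
    (M k hk).IsNConnected n where
  nontrivial := ⟨⟨e k .x₁, 0, e_x₁_ne_zero hk⟩⟩
  zero a ha _ := FreeCGA.exists_algebraMap_of_mem_deg_zero
    (fun g => lt_of_lt_of_le (by omega) (le_w hk g)) ha
  pos i hi a ha _ := by
    rw [deg_eq_bot hk (Nat.succ_ne_zero i) (by omega), Submodule.mem_bot] at ha
    exact ⟨0, Submodule.zero_mem _, by rw [map_zero, ha]⟩

/-! ### `M_k` is a minimal Sullivan algebra -/

theorem W_eq_bot (hk : Even k ∧ 4 < k) {n : ℕ} (hn : n ≤ 5 * k - 3) : W k hk n = ⊥ := by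
  rw [eq_bot_iff]
  refine Submodule.span_le.2 ?_
  rintro _ ⟨g, hg, rfl⟩
  have h1 := le_w hk g
  have h2 : w k g = n := hg
  omega

theorem e_mem_W (hk : Even k ∧ 4 < k) (g : Gen) : e k g ∈ W k hk (w k g) :=
  Submodule.subset_span ⟨g, rfl, rfl⟩

/-- The images of the generators satisfy the relations of `FreeCGA` because the target is
graded-commutative. Linearity extends agreement from the generators to their spans. -/
theorem W_free (hk : Even k ∧ 4 < k) (B : CGA) (f : ∀ n, W k hk n →ₗ[ℚ] B.carrier)
    (hf : ∀ n x, f n x ∈ B.deg n) :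
    ∃! F : CGA.Hom (M k hk).toCGA B, ∀ n (x : W k hk n), F.toAlgHom x = f n x := by
  set b : Gen → B.carrier := fun g => f (w k g) ⟨e k g, e_mem_W hk g⟩ with hb
  have hbdeg : ∀ g, b g ∈ B.deg (w k g) := fun g => hf _ _
  set F := FreeCGA.lift (w k) b (fun i j => B.comm (hbdeg i) (hbdeg j)) with hF
  have hFe : ∀ g, F (e k g) = b g := fun g => FreeCGA.lift_gen ..
  have hword : ∀ l, F (FreeCGA.word (w k) l) ∈ B.deg (FreeCGA.wt (w k) l) := by
    intro l
    induction l with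
    | nil => rw [FreeCGA.word_nil, map_one]; exact SetLike.one_mem_graded B.deg
    | cons g l ih =>
      rw [FreeCGA.word_cons, map_mul, FreeCGA.wt_cons]
      exact SetLike.mul_mem_graded (by rw [hFe]; exact hbdeg g) ih
  have hdeg : ∀ n, FreeCGA.deg (w k) n ≤ (B.deg n).comap F.toLinearMap := by
    intro n
    refine Submodule.span_le.2 ?_
    rintro _ ⟨l, rfl, rfl⟩
    exact hword l
  refine ⟨⟨F, fun {n a} ha => hdeg n ha⟩, ?_, ?_⟩
  · rintro n ⟨x, hx⟩
    change F x = f n ⟨x, hx⟩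
    induction hx using Submodule.span_induction with
    | mem x hx => obtain ⟨g, rfl, rfl⟩ := hx; exact hFe g
    | zero => exact (map_zero F).trans (map_zero (f n)).symm
    | add x y hx hy ihx ihy =>
      exact (map_add F x y).trans ((congrArg₂ (· + ·) ihx ihy).trans
        (map_add (f n) ⟨x, hx⟩ ⟨y, hy⟩).symm)
    | smul c x hx ih =>
      exact (map_smul F c x).trans ((congrArg (c • ·) ih).trans
        (map_smul (f n) c ⟨x, hx⟩).symm)
  · rintro ⟨G, hG⟩ hGf
    have : G = F := FreeCGA.algHom_ext (w := w k) (f := G) fun g =>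
      (hGf (w k g) ⟨e k g, e_mem_W hk g⟩).trans (hFe g).symm
    subst this
    rfl

/-- The stage of the Sullivan filtration in which a generator appears. -/
def level : Gen → ℕ
  | .x₁ => 0
  | .x₂ => 0
  | .y₁ => 1
  | .y₂ => 1
  | .y₃ => 1
  | .z => 2

/-- The span of the generators of degree `n` and of level at most `j`. -/
def filtration (k : ℕ) (j n : ℕ) : Submodule ℚ (FreeCGA (w k)) :=
  Submodule.span ℚ (e k '' {g | w k g = n ∧ level g ≤ j})

/-- The differentials of the `y`'s are polynomials in `x₁`, `x₂`, and `dz` involves only the `x`'s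
and `y`'s. -/
theorem v_mem_adjoin (g : Gen) (j : ℕ) (hg : level g ≤ j + 1) :
    v k g ∈ Algebra.adjoin ℚ (⋃ m, (filtration k j m : Set (FreeCGA (w k)))) := by
  set S := Algebra.adjoin ℚ (⋃ m, (filtration k j m : Set (FreeCGA (w k)))) with hS
  have he : ∀ g, level g ≤ j → e k g ∈ S := fun g hg =>
    Algebra.subset_adjoin (Set.mem_iUnion.2 ⟨w k g, Submodule.subset_span ⟨g, ⟨rfl, hg⟩, rfl⟩⟩)
  have h1 := he .x₁ (Nat.zero_le _)
  have h2 := he .x₂ (Nat.zero_le _)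
  cases g with
  | x₁ => exact S.zero_mem
  | x₂ => exact S.zero_mem
  | y₁ => exact S.mul_mem (S.pow_mem h1 _) h2
  | y₂ => exact S.mul_mem (S.pow_mem h1 _) (S.pow_mem h2 _)
  | y₃ => exact S.mul_mem h1 (S.pow_mem h2 _)
  | z =>
    have hj : 1 ≤ j := Nat.le_of_succ_le_succ hg
    have h3 := he .y₁ hj
    have h4 := he .y₂ hj
    have h5 := he .y₃ hj
    refine S.add_mem (S.add_mem (S.mul_mem (S.pow_mem h1 _) (S.add_mem (S.sub_mem ?_ ?_) ?_))
      (S.pow_mem h1 _)) (S.pow_mem h2 _)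
    · exact S.mul_mem (S.mul_mem (S.pow_mem h1 _) h4) h5
    · exact S.mul_mem (S.mul_mem (S.mul_mem h1 h2) h3) h5
    · exact S.mul_mem (S.mul_mem (S.pow_mem h2 _) h3) h4

theorem W_nilpotent (hk : Even k ∧ 4 < k) : ∃ F : ℕ → ℕ → Submodule ℚ (M k hk).carrier,
    (∀ n, Monotone fun j => F j n) ∧ (∀ n, ⨆ j, F j n = W k hk n) ∧
    (∀ n, ∀ x ∈ F 0 n, (M k hk).d x = 0) ∧
    (∀ j n, ∀ x ∈ F (j + 1) n,
      (M k hk).d x ∈ Algebra.adjoin ℚ (⋃ m, (F j m : Set (M k hk).carrier))) := by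
  refine ⟨filtration k, ?_, ?_, ?_, ?_⟩
  · exact fun n i j hij => Submodule.span_mono (Set.image_mono fun g hg => ⟨hg.1, hg.2.trans hij⟩)
  · intro n
    refine le_antisymm (iSup_le fun j => Submodule.span_mono (Set.image_mono fun g hg => hg.1)) ?_
    refine le_iSup_of_le 2 (Submodule.span_mono (Set.image_mono fun g hg => ⟨hg, ?_⟩))
    cases g <;> simp [level]
  · intro n
    change filtration k 0 n ≤ LinearMap.ker (M k hk).d
    refine Submodule.span_le.2 ?_
    rintro _ ⟨g, ⟨-, hg⟩, rfl⟩
    refine (d_e hk g).trans ?_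
    cases g <;> first | rfl | simp [level] at hg
  · intro j n
    change filtration k (j + 1) n ≤ (Subalgebra.toSubmodule
      (Algebra.adjoin ℚ (⋃ m, (filtration k j m : Set (FreeCGA (w k)))))).comap (M k hk).d
    refine Submodule.span_le.2 ?_
    rintro _ ⟨g, ⟨-, hg⟩, rfl⟩
    have := v_mem_adjoin (k := k) g j hg
    rw [← d_e hk g] at this
    exact this

theorem v_mem_decomposable (hk : Even k ∧ 4 < k) (V : Submodule ℚ (FreeCGA (w k)))
    (hV : ∀ g, e k g ∈ V) (g : Gen) : v k g ∈ ⨆ j, V ^ (j + 2) := by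
  have of_mem : ∀ {n : ℕ} {a : FreeCGA (w k)}, 2 ≤ n → a ∈ V ^ n → a ∈ ⨆ j, V ^ (j + 2) := by
    intro n a hn ha
    obtain ⟨j, rfl⟩ := Nat.exists_eq_add_of_le' hn
    exact Submodule.mem_iSup_of_mem j ha
  have mul : ∀ {m n : ℕ} {a b : FreeCGA (w k)}, a ∈ V ^ m → b ∈ V ^ n → a * b ∈ V ^ (m + n) :=
    fun ha hb => by rw [pow_add]; exact Submodule.mul_mem_mul ha hb
  have one : ∀ g, e k g ∈ V ^ 1 := fun g => by rw [pow_one]; exact hV g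
  have pow : ∀ g n, e k g ^ n ∈ V ^ n := fun g n => Submodule.pow_mem_pow V (hV g) n
  obtain ⟨m, -, -, -, -, -, -, h7, h8, h9⟩ := w_values hk
  cases g with
  | x₁ => exact Submodule.zero_mem _
  | x₂ => exact Submodule.zero_mem _
  | y₁ => exact of_mem (by norm_num) (mul (pow _ 3) (one _))
  | y₂ => exact of_mem (by norm_num) (mul (pow _ 2) (pow _ 2))
  | y₃ => exact of_mem (by norm_num) (mul (one _) (pow _ 3))
  | z =>
    simp only [v, h7, h8, h9]
    refine Submodule.add_mem _ (Submodule.add_mem _ ?_ ?_) ?_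
    -- Each of the three products in the bracket has word length 4.
    · refine of_mem (n := 6 * m + 6 + 4) (by omega) (mul (pow _ _)
        (Submodule.add_mem _ (Submodule.sub_mem _ ?_ ?_) ?_))
      · exact mul (mul (pow _ 2) (one _)) (one _)
      · exact mul (mul (mul (one _) (one _)) (one _)) (one _)
      · exact mul (mul (pow _ 2) (one _)) (one _)
    · exact of_mem (by omega) (pow _ _)
    · exact of_mem (by omega) (pow _ _)

theorem isMinimalSullivan (hk : Even k ∧ 4 < k) : (M k hk).IsMinimalSullivan (W k hk) where
  le_deg n := by
    refine Submodule.span_le.2 ?_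
    rintro _ ⟨g, rfl, rfl⟩
    exact FreeCGA.gen_mem (w k) g
  zero := W_eq_bot hk (by omega)
  one := W_eq_bot hk (by omega)
  finite n := by
    have hfin : (Set.univ : Set Gen).Finite :=
      (Set.toFinite {Gen.x₁, .x₂, .y₁, .y₂, .y₃, .z}).subset fun g _ => by cases g <;> simp
    have : FiniteDimensional ℚ
        (Submodule.span ℚ (e k '' {g | w k g = n}) : Submodule ℚ (FreeCGA (w k))) :=
      FiniteDimensional.span_of_finite ℚ ((hfin.subset (Set.subset_univ _)).image (e k))
    exact this
  free := W_free hk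
  nilpotent := W_nilpotent hk
  minimal n := by
    change W k hk n ≤ (⨆ j, (⨆ m, W k hk m) ^ (j + 2)).comap (M k hk).d
    refine Submodule.span_le.2 ?_
    rintro _ ⟨g, rfl, rfl⟩
    have := v_mem_decomposable hk (⨆ m, W k hk m)
      (fun g => le_iSup (W k hk) (w k g) (e_mem_W hk g)) g
    rw [← d_e hk g] at this
    exact this

end RigidAlgebra

end

theorem mainTheorem1 :
    (∀ (k : ℕ) (hk : Even k ∧ 4 < k),
      -- `M_k` is a minimal Sullivan algebra, and it is `(5k-3)`-connected
      (RigidAlgebra.M k hk).IsMinimalSullivan (RigidAlgebra.W k hk) ∧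
      (∀ i ≤ 5 * k - 3, RigidAlgebra.W k hk i = ⊥) ∧
      (RigidAlgebra.M k hk).IsNConnected (5 * k - 3) ∧
      -- homotopy is a congruence on the monoid of self-maps of `M_k`, and the quotient monoid
      -- consists of exactly two elements, the classes of the zero map and of the identity
      (∃ c : Con (CDGA.Hom (RigidAlgebra.M k hk) (RigidAlgebra.M k hk)),
        (∀ f g, c f g ↔ CDGA.Homotopic f g) ∧
        (RigidAlgebra.zeroMap k hk : c.Quotient) ≠ (CDGA.Hom.id (RigidAlgebra.M k hk) : c.Quotient) ∧
        ∀ q : c.Quotient, q = (RigidAlgebra.zeroMap k hk : c.Quotient) ∨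
          q = (CDGA.Hom.id (RigidAlgebra.M k hk) : c.Quotient)) ∧
      (RigidAlgebra.M k hk).IsHomotopicallyRigid) ∧
    -- the `M_k` are pairwise not homotopy equivalent
    (∀ (k l : ℕ) (hk : Even k ∧ 4 < k) (hl : Even l ∧ 4 < l)
      (f : CDGA.Hom (RigidAlgebra.M k hk) (RigidAlgebra.M l hl)),
      CDGA.IsHomotopyEquiv f → k = l) ∧
    -- hence, for every `n`, infinitely many of them are `n`-connected
    (∀ n : ℕ, {k : ℕ | ∃ hk : Even k ∧ 4 < k, (∀ i ≤ n, RigidAlgebra.W k hk i = ⊥) ∧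
      (RigidAlgebra.M k hk).IsNConnected n ∧
      (RigidAlgebra.M k hk).IsHomotopicallyRigid}.Infinite) := by
  -- The congruence is `⊥`, that is equality, since homotopic self-maps are equal.
  refine ⟨fun k hk => ⟨RigidAlgebra.isMinimalSullivan hk, fun i hi => RigidAlgebra.W_eq_bot hk hi,
    RigidAlgebra.isNConnected hk le_rfl, ⟨⊥, fun f g => ?_, ?_, ?_⟩,
    RigidAlgebra.isHomotopicallyRigid hk⟩, ?_, ?_⟩
  · exact (RigidAlgebra.homotopic_iff_eq hk).symm
  · exact fun h => RigidAlgebra.zeroMap_ne_id hk ((Con.eq _).1 h)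
  · intro q
    induction q using Con.induction_on with
    | H f => exact (RigidAlgebra.eq_zeroMap_or_eq_id hk f).imp (congrArg _) (congrArg _)
  · rintro k l hk hl f ⟨g, hgf, hfg⟩
    exact le_antisymm (RigidAlgebra.le_of_isHomotopyEquiv hl hk g f hfg)
      (RigidAlgebra.le_of_isHomotopyEquiv hk hl f g hgf)
  · intro n
    -- The values `k = 2(n + j) + 6` are even, greater than 4, and satisfy `n ≤ 5k - 3`.
    refine Set.infinite_of_injective_forall_mem (f := fun j : ℕ => 2 * (n + j) + 6)
      (fun i j h => by simpa using h) fun j => ?_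
    have hk : Even (2 * (n + j) + 6) ∧ 4 < 2 * (n + j) + 6 := ⟨⟨n + j + 3, by ring⟩, by omega⟩
    exact ⟨hk, fun i hi => RigidAlgebra.W_eq_bot hk (by omega),
      RigidAlgebra.isNConnected hk (by omega), RigidAlgebra.isHomotopicallyRigid hk⟩
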